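/- Let $\mathsf k$ be an infinite field, let $u>r\ge 2$ be integers, $Q=(u,u-r)$, and let $1\le k\le r-1$, $1\le l\le u-r$. **Matrices.** Let $J_Q$ be the nilpotent (upper triangular) Jordan matrix with blocks of sizes $u$ and $u-r$, and let $\mathcal N_{J_Q}$ be the set of nilpotent matrices over $\mathsf k$ commuting with $J_Q$. For $A\in\mathcal N_{J_Q}$, in block form for $u+(u-r)$ and with columns numbered from $0$ in each block, let $a_i$ $(0\le i\le u-1)$ be the first row of the upper left block, $b_i$ $(0\le i\le u-r-1)$ the first row of the lower right block, $g_j$ $(0\le j\le u-r-1)$ the first row of the upper right block, and $h_j$ $(0\le j\le u-r-1)$ the entry in the first row and column $r+j$ of the lower left block. Let $X^Q_{k,l}\subseteq\mathcal N_{J_Q}$ be the set of $A$ satisfying the equations $E^Q_{k,l}$: * if $k+l\le r$: $a_1=\dots=a_{k-1}=0$ and $b_1=\dots=b_{l-1}=0$; * if $k+l\ge r+1$: $a_1=\dots=a_{k-1}=0$, $b_1=\dots=b_{r-k-1}=0$, and $\sum_{j=0}^{m}\bigl(a_{k+j}\,b_{r-k+m-j}-g_j\,h_{m-j}\bigr)=0$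 for $0\le m\le k+l-r-1$. **The table $\mathcal T(Q)$.** Write $[n]^p$ for the partition of $n$ into $p$ parts that differ pairwise by at most one. Put $t_{\max}=\min\{u-r,\lfloor\frac{r-1}2\rfloor\}$, $k_0=1$, and for $1\le t\le t_{\max}$ $$q_t=\Big\lceil\frac{u-r}{t}\Big\rceil,\quad d_t=tq_t-(u-r),\quad k_t=t+\Big\lfloor\frac{r-2t}{q_t+1}\Big\rfloor+1,\quad c_t=\begin{cases}t+\big\lceil\frac{r-2t}{q_t}\big\rceil & d_t>0,\\ k_t & d_t=0.\end{cases}$$ For $1\le t\le t_{\max}$ let $A_t=\{(k,l): k_{t-1}\le k<k_t,\ t\le l\le u-r\}$, $C_t=\{(k,t): k_t\le k<c_t\}$, $B_t=\{(k,t): c_t\le k\le r-t\}\cup\{(r-t,l): t<l\le u-r\}$; and for $T=t_{\max}+1$ let $A_T=\{(k,l): k=k_{t_{\max}}=r-T,\ T\le l\le u-r\}$. The entry $P_{k,l}(Q)$ of the table is $$P_{k,l}(Q)=\begin{cases}\bigl([u]^k,[u-r]^l\bigr) & (k,l)\in A_t,\ 1\le t\le T,\\ \bigl([u-r+2t]^t,[u-2t-d_t(q_t-1)]^{k-d_t},(q_t-1)^{d_t}\bigr)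 & (k,l)\in C_t,\ 1\le t\le t_{\max},\\ \bigl([u-r+2t]^t,[u-2t]^{k+l-t}\bigr) & (k,l)\in B_t,\ 1\le t\le t_{\max}.\end{cases}$$ **Theorem 4.1.** The table has an entry $P_{k,l}(Q)$ at $(k,l)$, and the Jordan type of a generic matrix $A\in X^Q_{k,l}$ is $P_{k,l}(Q)$. That is, $(k,l)$ belongs to at least one of the sets above, and for every partition $P$ assigned to $(k,l)$ by the rules above there is a polynomial $F$ in the matrix entries such that $\{A\in X^Q_{k,l}: F(A)\ne 0\}$ is Zariski dense in $X^Q_{k,l}$ and every matrix in this set is similar to the nilpotent Jordan matrix whose block sizes are the parts of $P$. -/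

import Mathlib

/-! ### Jordan matrices and Jordan types -/

/-- The nilpotent Jordan block of size `n` (ones on the superdiagonal). -/
def jordanBlock (K : Type*) [Field K] (n : ℕ) : Matrix (Fin n) (Fin n) K :=
  Matrix.of fun i j => if i.val + 1 = j.val then 1 else 0

/-- The nilpotent Jordan matrix with blocks of the sizes listed in `L`. -/
def jordanMatrix (K : Type*) [Field K] (L : List ℕ) :
    Matrix (Σ i : Fin L.length, Fin (L.get i)) (Σ i : Fin L.length, Fin (L.get i)) K :=
  Matrix.blockDiagonal' fun i : Fin L.length => jordanBlock K (L.get i)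

/-- `A` has Jordan type `P`: all the parts of `P` are positive, and `A` is similar to the
nilpotent Jordan matrix whose block sizes are the parts of `P` (listed in some order; `e` is the
identification of the two index sets). -/
def HasJordanType {ι K : Type*} [Fintype ι] [DecidableEq ι] [Field K]
    (A : Matrix ι ι K) (P : Multiset ℕ) : Prop :=
  0 ∉ P ∧ ∃ L : List ℕ, (L : Multiset ℕ) = P ∧
    ∃ (e : ι ≃ Σ i : Fin L.length, Fin (L.get i)) (S : (Matrix ι ι K)ˣ),
      A = (S : Matrix ι ι K) * (jordanMatrix K L).submatrix e e * ((S⁻¹ : (Matrix ι ι K)ˣ) : Matrix ι ι K)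

/-! ### The nilpotent commutator of `J_Q` for `Q = (u, u - r)` -/

/-- The Jordan matrix `J_Q` of the partition `Q = (u, u - r)`. -/
def jordanQ (K : Type*) [Field K] (u r : ℕ) :
    Matrix (Fin u ⊕ Fin (u - r)) (Fin u ⊕ Fin (u - r)) K :=
  Matrix.fromBlocks (jordanBlock K u) 0 0 (jordanBlock K (u - r))

/-- The nilpotent commutator: all nilpotent matrices that commute with `J_Q`. -/
def nilCommutator (K : Type*) [Field K] (u r : ℕ) :
    Set (Matrix (Fin u ⊕ Fin (u - r)) (Fin u ⊕ Fin (u - r)) K) :=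
  {A | IsNilpotent A ∧ Commute A (jordanQ K u r)}

section Coordinates

variable {K : Type*} [Field K] {u r : ℕ}

/-- `a_i`: the entry in the first row of the upper left block, column `i` (counted from `0`). -/
def coordA (A : Matrix (Fin u ⊕ Fin (u - r)) (Fin u ⊕ Fin (u - r)) K) (i : ℕ) : K :=
  if h : i < u then A (Sum.inl ⟨0, by omega⟩) (Sum.inl ⟨i, h⟩) else 0

/-- `b_i`: the entry in the first row of the lower right block, column `i` (counted from `0`). -/
def coordB (A : Matrix (Fin u ⊕ Fin (u - r)) (Fin u ⊕ Fin (u - r)) K) (i : ℕ) : K :=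
  if h : i < u - r then A (Sum.inr ⟨0, by omega⟩) (Sum.inr ⟨i, h⟩) else 0

/-- `g_j`: the entry in the first row of the upper right block, column `j` (counted from `0`). -/
def coordG (A : Matrix (Fin u ⊕ Fin (u - r)) (Fin u ⊕ Fin (u - r)) K) (j : ℕ) : K :=
  if h : j < u - r then A (Sum.inl ⟨0, by omega⟩) (Sum.inr ⟨j, h⟩) else 0

/-- `h_j`: the entry in the first row of the lower left block, column `r + j`
(counted from `0`). -/
def coordH (A : Matrix (Fin u ⊕ Fin (u - r)) (Fin u ⊕ Fin (u - r)) K) (j : ℕ) : K :=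
  if h : j < u - r then A (Sum.inr ⟨0, by omega⟩) (Sum.inl ⟨r + j, by omega⟩) else 0

/-- The equations `E^Q_{k,l}` hold for the entries of `A`. -/
def SatisfiesE (k l : ℕ) (A : Matrix (Fin u ⊕ Fin (u - r)) (Fin u ⊕ Fin (u - r)) K) : Prop :=
  if k + l ≤ r then
    (∀ i, 1 ≤ i → i < k → coordA A i = 0) ∧ (∀ i, 1 ≤ i → i < l → coordB A i = 0)
  else
    (∀ i, 1 ≤ i → i < k → coordA A i = 0) ∧ (∀ i, 1 ≤ i → i < r - k → coordB A i = 0) ∧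
    ∀ m, m < k + l - r →
      ∑ j ∈ Finset.range (m + 1),
        (coordA A (k + j) * coordB A (r - k + (m - j)) - coordG A j * coordH A (m - j)) = 0

end Coordinates

/-- The locus `X^Q_{k,l}` of the equations `E^Q_{k,l}` in the nilpotent commutator of `J_Q`. -/
def locusX (K : Type*) [Field K] (u r k l : ℕ) :
    Set (Matrix (Fin u ⊕ Fin (u - r)) (Fin u ⊕ Fin (u - r)) K) :=
  {A | A ∈ nilCommutator K u r ∧ SatisfiesE k l A}

/-- `p` holds for the generic element of the set `X` of matrices: there is a polynomial `F` in the
matrix entries such that `p` holds at every point of `X` where `F` does not vanish, and such that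
the set of these points is Zariski dense in `X` (it meets every nonempty basic Zariski open
subset `{G ≠ 0}` of `X`). -/
def HoldsGenerically {ι K : Type*} [Field K] (X : Set (Matrix ι ι K))
    (p : Matrix ι ι K → Prop) : Prop :=
  ∃ F : MvPolynomial (ι × ι) K,
    (∀ A ∈ X, MvPolynomial.eval (fun x : ι × ι => A x.1 x.2) F ≠ 0 → p A) ∧
    ∀ G : MvPolynomial (ι × ι) K,
      (∃ A ∈ X, MvPolynomial.eval (fun x : ι × ι => A x.1 x.2) G ≠ 0) →
      ∃ A ∈ X, MvPolynomial.eval (fun x : ι × ι => A x.1 x.2) G ≠ 0 ∧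
        MvPolynomial.eval (fun x : ι × ι => A x.1 x.2) F ≠ 0

/-! ### The table `T(Q)` for `Q = (u, u - r)` -/

/-- `[n]^k`: the almost rectangular partition of `n` into `k` parts (used for `1 ≤ k ≤ n`). -/
def almostRect (n k : ℕ) : Multiset ℕ :=
  Multiset.replicate (n % k) (n / k + 1) + Multiset.replicate (k - n % k) (n / k)

/-- `t_max = min {u - r, ⌊(r - 1) / 2⌋}`. -/
def tableTMax (u r : ℕ) : ℕ := min (u - r) ((r - 1) / 2)

/-- `q_t = ⌈(u - r) / t⌉`. -/
def tableQ (u r t : ℕ) : ℕ := (u - r) ⌈/⌉ t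

/-- `d_t = t q_t - (u - r)`, so that `u - r = t q_t - d_t` with `0 ≤ d_t < t`. -/
def tableD (u r t : ℕ) : ℕ := t * tableQ u r t - (u - r)

/-- `k_0 = 1` and `k_t = t + ⌊(r - 2t) / (q_t + 1)⌋ + 1` for `t ≥ 1`. -/
def tableK (u r t : ℕ) : ℕ :=
  if t = 0 then 1 else t + (r - 2 * t) / (tableQ u r t + 1) + 1

/-- `c_t = t + ⌈(r - 2t) / q_t⌉` if `d_t > 0`, and `c_t = k_t` (no type C entries in hook `t`) if
`d_t = 0`. -/
def tableC (u r t : ℕ) : ℕ :=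
  if tableD u r t = 0 then tableK u r t else t + (r - 2 * t) ⌈/⌉ tableQ u r t

/-- The set `A_t`, for `1 ≤ t ≤ t_max`. -/
def setA (u r t : ℕ) : Set (ℕ × ℕ) :=
  {x | tableK u r (t - 1) ≤ x.1 ∧ x.1 < tableK u r t ∧ t ≤ x.2 ∧ x.2 ≤ u - r}

/-- The set `A_T`, for `T = t_max + 1`. -/
def setALast (u r : ℕ) : Set (ℕ × ℕ) :=
  {x | x.1 = tableK u r (tableTMax u r) ∧ x.1 = r - (tableTMax u r + 1) ∧
    tableTMax u r + 1 ≤ x.2 ∧ x.2 ≤ u - r}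

/-- The set `C_t`, for `1 ≤ t ≤ t_max`. -/
def setC (u r t : ℕ) : Set (ℕ × ℕ) :=
  {x | tableK u r t ≤ x.1 ∧ x.1 < tableC u r t ∧ x.2 = t}

/-- The set `B_t`, for `1 ≤ t ≤ t_max`. -/
def setB (u r t : ℕ) : Set (ℕ × ℕ) :=
  {x | tableC u r t ≤ x.1 ∧ x.1 ≤ r - t ∧ x.2 = t} ∪
    {x | x.1 = r - t ∧ t < x.2 ∧ x.2 ≤ u - r}

/-- `IsTableEntry u r k l P`: the table `T(Q)`, `Q = (u, u - r)`, has the partition `P` as its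
entry `P_{k,l}(Q)`. -/
inductive IsTableEntry (u r k l : ℕ) : Multiset ℕ → Prop
  | typeA (t : ℕ) (h1 : 1 ≤ t) (ht : t ≤ tableTMax u r) (h : (k, l) ∈ setA u r t) :
      IsTableEntry u r k l (almostRect u k + almostRect (u - r) l)
  | typeALast (h : (k, l) ∈ setALast u r) :
      IsTableEntry u r k l (almostRect u k + almostRect (u - r) l)
  | typeC (t : ℕ) (h1 : 1 ≤ t) (ht : t ≤ tableTMax u r) (h : (k, l) ∈ setC u r t) :
      IsTableEntry u r k l
        (almostRect (u - r + 2 * t) t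
          + almostRect (u - 2 * t - tableD u r t * (tableQ u r t - 1)) (k - tableD u r t)
          + Multiset.replicate (tableD u r t) (tableQ u r t - 1))
  | typeB (t : ℕ) (h1 : 1 ≤ t) (ht : t ≤ tableTMax u r) (h : (k, l) ∈ setB u r t) :
      IsTableEntry u r k l
        (almostRect (u - r + 2 * t) t + almostRect (u - 2 * t) (k + l - t))

/-! Write s = u - r. A matrix commuting with J_Q is K[X]-linear on K[X]/(X^u) ⊕ K[X]/(X^s), so it is
the truncation `commMat` of a 2×2 matrix N of power series whose lower left entry is divisible by
X^r; products correspond to products. In this language the locus consists of N = [X^k α, γ; X^r η,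
X^b β] with b = min(l, r-k) and X^(k+l-r) ∣ αβ - γη, which forces X^(k+l) ∣ det N.

A nilpotent matrix has Jordan type P exactly when P has no part 0 and each A^t has corank equal to
the sum of min(t, p) over the parts p (`hasJordanType_of_rank_pow`). Let m = min(k, l, r-k).
Expanding N^t over walks on two vertices shows that the order of its upper left entry is at least
e_t = min(tk, r - 2m + tm). If equality holds below u, and A itself has corank at most k+l, then A^t
has corank min(t(k+l), s + e_t, u + s) (`rank_pow_add_genericCorank`): the upper bounds come from
Sylvester's inequality and a triangular minor, the lower bound from divisibility of det N^t.
`IsTableEntry.spec` checks that every table entry yields these same numbers.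

Both genericity conditions are nonvanishing of polynomials. The locus need not be parametrized
outright, but the symbols for which [α, γ; η, β] is a column times a row modulo X^(k+l-r) form a
polynomial image of an affine space, and a polynomial nonzero somewhere on the locus is nonzero
somewhere on this family (`nonvanishingOnFamily_of_eval_ne_zero`). Over an infinite field finitely
many such conditions hold simultaneously, so it is enough to give one witness for each. -/

/-! ### Jordan types and ranks of powers -/

open Polynomial in
theorem exists_basis_quotient_X_pow (K : Type*) [Field K] (k : ℕ) :
    ∃ c : Module.Basis (Fin k) K (K[X] ⧸ Submodule.span K[X] {(X : K[X]) ^ k}),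
      ∀ j : Fin k, (X : K[X]) • c j =
        if h : j.val = 0 then 0 else c ⟨j.val - 1, by omega⟩ := by
  have hd : (AdjoinRoot.powerBasis' (monic_X_pow (R := K) k)).dim = k := by
    rw [AdjoinRoot.powerBasis'_dim, natDegree_X_pow]
  -- The power basis is reversed so that multiplication by X lowers the index.
  let b : Module.Basis (Fin k) K (AdjoinRoot ((X : K[X]) ^ k)) :=
    (AdjoinRoot.powerBasis' (monic_X_pow k)).basis.reindex
      ((finCongr hd).trans Fin.revPerm)
  have hb : ∀ j, b j = AdjoinRoot.mk ((X : K[X]) ^ k) ((X : K[X]) ^ (k - 1 - j.val)) := by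
    intro j
    have h1 : k - (j.val + 1) = k - 1 - j.val := by omega
    simp only [b]
    rw [Module.Basis.reindex_apply, PowerBasis.basis_eq_pow, AdjoinRoot.powerBasis'_gen]
    simp [h1, Fin.val_rev]
  let b' : Module.Basis (Fin k) K (K[X] ⧸ Submodule.span K[X] {(X : K[X]) ^ k}) := b
  have hb' : ∀ j, b' j = Submodule.Quotient.mk ((X : K[X]) ^ (k - 1 - j.val)) := hb
  refine ⟨b', fun j => ?_⟩
  have : (X : K[X]) • b' j = Submodule.Quotient.mk ((X : K[X]) ^ (k - 1 - j.val + 1)) := by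
    rw [hb', pow_succ', ← Submodule.Quotient.mk_smul, smul_eq_mul]
  rw [this]
  split_ifs with h
  · rw [h]
    have : k - 1 - 0 + 1 = k := by have := j.2; omega
    rw [this]
    exact (Submodule.Quotient.mk_eq_zero _).2 (Submodule.mem_span_singleton_self _)
  · rw [hb']
    congr 2
    have := j.2
    simp only
    omega

-- Through f the space is a K[X]-module, and nilpotency makes it X-power torsion; the structure
-- theorem over the principal ideal domain K[X] splits it into summands K[X]/(X^k).
open Polynomial DirectSum in
theorem exists_jordan_basis {K V : Type*} [Field K] [AddCommGroup V] [Module K V]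
    [FiniteDimensional K V] (f : Module.End K V) (hf : IsNilpotent f) :
    ∃ (d : ℕ) (k : Fin d → ℕ) (c : Module.Basis (Σ i, Fin (k i)) K V),
      ∀ x : Σ i, Fin (k i), f (c x) =
        if h : x.2.val = 0 then 0 else c ⟨x.1, ⟨x.2.val - 1, by omega⟩⟩ := by
  obtain ⟨N, hN⟩ := hf
  have htor : Module.IsTorsion' (Module.AEval' f) (Submonoid.powers (X : K[X])) := by
    intro x
    refine ⟨⟨X ^ N, N, rfl⟩, ?_⟩
    obtain ⟨v, rfl⟩ := (Module.AEval'.of f).surjective x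
    change (X ^ N : K[X]) • Module.AEval'.of f v = 0
    rw [Module.AEval'.X_pow_smul_of, hN]
    simp
  obtain ⟨d, k, ⟨Ψ⟩⟩ := Module.torsion_by_prime_power_decomposition
    (p := (X : K[X])) irreducible_X htor
  choose c hc using fun i => exists_basis_quotient_X_pow K (k i)
  let Ψ' : V ≃ₗ[K] (Π i, K[X] ⧸ Submodule.span K[X] {(X : K[X]) ^ (k i)}) :=
    (Module.AEval'.of f).trans
      ((Ψ.trans (DirectSum.linearEquivFunOnFintype K[X] (Fin d) _)).restrictScalars K)
  have hX : ∀ v, Ψ' (f v) = (X : K[X]) • Ψ' v := by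
    intro v
    simp only [Ψ', LinearEquiv.trans_apply, LinearEquiv.restrictScalars_apply]
    rw [← Module.AEval'.X_smul_of]
    simp only [map_smul]
  refine ⟨d, k, (Pi.basis c).map Ψ'.symm, fun x => ?_⟩
  apply Ψ'.injective
  rw [hX]
  obtain ⟨i, j⟩ := x
  simp only [Module.Basis.map_apply, LinearEquiv.apply_symm_apply, Pi.basis_apply]
  rw [← Pi.single_smul, hc]
  split_ifs with h
  · simp
  · simp

theorem jordanMatrix_apply (K : Type*) [Field K] (L : List ℕ)
    (x y : Σ i : Fin L.length, Fin (L.get i)) :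
    jordanMatrix K L x y = if x.1 = y.1 ∧ x.2.val + 1 = y.2.val then 1 else 0 := by
  obtain ⟨i, a⟩ := x
  obtain ⟨j, b⟩ := y
  by_cases h : i = j
  · subst h
    simp [jordanMatrix, jordanBlock]
  · simp [jordanMatrix, Matrix.blockDiagonal'_apply_ne _ _ _ h, h]

theorem jordanMatrix_pow_apply (K : Type*) [Field K] (L : List ℕ) (t : ℕ)
    (x y : Σ i : Fin L.length, Fin (L.get i)) :
    (jordanMatrix K L ^ t) x y = if x.1 = y.1 ∧ x.2.val + t = y.2.val then 1 else 0 := by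
  induction t generalizing x with
  | zero =>
    rw [pow_zero, Matrix.one_apply]
    congr 1
    obtain ⟨i, a⟩ := x
    obtain ⟨j, b⟩ := y
    simp only [Sigma.mk.injEq, add_zero, eq_iff_iff]
    constructor
    · rintro ⟨rfl, h⟩
      simpa [Fin.ext_iff] using h
    · rintro ⟨rfl, h⟩
      simpa [Fin.ext_iff] using h
  | succ t ih =>
    rw [pow_succ', Matrix.mul_apply]
    simp only [jordanMatrix_apply, ih]
    obtain ⟨i, a⟩ := x
    by_cases ha : a.val + 1 < L.get i
    · rw [Finset.sum_eq_single ⟨i, ⟨a.val + 1, ha⟩⟩]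
      · simp [add_assoc, add_comm 1 t]
      · rintro ⟨j, b⟩ - hne
        rw [if_neg, zero_mul]
        rintro ⟨h1, h2⟩
        simp only at h1 h2
        subst h1
        apply hne
        simp [h2]
      · simp
    · rw [Finset.sum_eq_zero, if_neg]
      · rintro ⟨h1, h2⟩
        obtain ⟨j, b⟩ := y
        simp only at h1 h2
        subst h1
        omega
      · rintro ⟨j, b⟩ -
        rw [if_neg, zero_mul]
        rintro ⟨h1, h2⟩
        simp only at h1 h2
        subst h1
        omega

/-- If the coordinates in `S` separate the points of a subspace, then its dimension is at most the
cardinality of `S`. -/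
theorem finrank_le_card_of_coords {K ι : Type*} [Field K] [Fintype ι] (W : Submodule K (ι → K))
    (S : Finset ι) (h : ∀ w ∈ W, (∀ i ∈ S, w i = 0) → w = 0) :
    Module.finrank K W ≤ S.card := by
  let φ : W →ₗ[K] (S → K) := (LinearMap.funLeft K K (fun i : S => (i : ι))).comp W.subtype
  have hφ : Function.Injective φ := by
    rw [← LinearMap.ker_eq_bot, LinearMap.ker_eq_bot']
    intro w hw
    apply Subtype.ext
    refine h w w.2 fun i hi => ?_
    exact congrFun hw ⟨i, hi⟩
  simpa using LinearMap.finrank_le_finrank_of_injective hφ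

/-- If some rows and columns of `A` cut out an invertible square block, then the rank of `A` is at
least the size of that block. -/
theorem card_le_rank_of_det_submatrix_ne_zero {K ι κ : Type*} [Field K] [Fintype ι]
    [Fintype κ] [DecidableEq κ] (A : Matrix ι ι K) (f g : κ → ι)
    (h : (A.submatrix f g).det ≠ 0) : Fintype.card κ ≤ A.rank := by
  classical
  calc Fintype.card κ = (A.submatrix f g).rank :=
        (Matrix.rank_of_isUnit _ ((Matrix.isUnit_iff_isUnit_det _).2 h.isUnit)).symm
    _ ≤ _ := Matrix.rank_submatrix_le _ _ _

theorem card_sigma_lt (L : List ℕ) (t : ℕ) :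
    (Finset.univ.filter fun x : Σ i : Fin L.length, Fin (L.get i) => x.2.val < t).card
      = (L.map (min t)).sum := by
  have : (Finset.univ.filter fun x : Σ i : Fin L.length, Fin (L.get i) => x.2.val < t)
      = Finset.univ.sigma fun i : Fin L.length =>
        (Finset.univ : Finset (Fin (L.get i))).filter fun j => j.val < t := by
    ext ⟨i, j⟩; simp
  rw [this, Finset.card_sigma]
  have h2 : ∀ i : Fin L.length,
      ((Finset.univ : Finset (Fin (L.get i))).filter fun j => j.val < t).card
        = min t (L.get i) := by
    intro i
    rw [Fin.card_filter_val_lt, min_comm]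
  simp only [h2]
  rw [← List.sum_ofFn]
  congr 1
  apply List.ext_get <;> simp

/-- In the t-th power the columns at positions below t vanish, and the others contain an identity
block. -/
theorem rank_jordanMatrix_pow (K : Type*) [Field K] (L : List ℕ) (t : ℕ) :
    (jordanMatrix K L ^ t).rank + (L.map (min t)).sum
      = Fintype.card (Σ i : Fin L.length, Fin (L.get i)) := by
  classical
  rw [← card_sigma_lt, ← Finset.card_univ,
    ← Finset.card_filter_add_card_filter_not (s := Finset.univ)
      (fun x : Σ i : Fin L.length, Fin (L.get i) => x.2.val < t), add_comm]
  congr 1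
  set J := jordanMatrix K L ^ t with hJ
  apply le_antisymm
  · rw [← Matrix.rank_transpose, Matrix.rank]
    apply finrank_le_card_of_coords
    rintro _ ⟨v, rfl⟩ h
    ext y
    by_cases hy : y.2.val < t
    · rw [Matrix.mulVecLin_apply, Matrix.mulVec, dotProduct]
      apply Finset.sum_eq_zero
      intro x _
      rw [Matrix.transpose_apply, hJ, jordanMatrix_pow_apply, if_neg, zero_mul]
      rintro ⟨-, h2⟩
      omega
    · exact h y (by simpa using hy)
  · let κ := {x : Σ i : Fin L.length, Fin (L.get i) // ¬ x.2.val < t}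
    have hdet : (J.submatrix (fun x : κ => ⟨x.1.1, ⟨x.1.2.val - t, by omega⟩⟩)
        (fun x : κ => x.1)) = 1 := by
      ext ⟨⟨i, a⟩, ha⟩ ⟨⟨j, b⟩, hb⟩
      simp only at ha hb
      rw [Matrix.submatrix_apply, hJ, jordanMatrix_pow_apply, Matrix.one_apply]
      congr 1
      simp only [Subtype.mk.injEq, Sigma.mk.injEq, eq_iff_iff]
      have : a.val - t + t = a.val := by omega
      rw [this]
      constructor
      · rintro ⟨rfl, h⟩
        simpa [Fin.ext_iff] using h
      · rintro ⟨rfl, h⟩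
        simpa [Fin.ext_iff] using h
    have := card_le_rank_of_det_submatrix_ne_zero J _ _
      (by rw [hdet, Matrix.det_one]; exact one_ne_zero)
    rwa [Fintype.card_subtype] at this

theorem HasJordanType.rank_pow {ι K : Type*} [Fintype ι] [DecidableEq ι] [Field K]
    {A : Matrix ι ι K} {P : Multiset ℕ} (h : HasJordanType A P) (t : ℕ) :
    (A ^ t).rank + (P.map (min t)).sum = Fintype.card ι := by
  obtain ⟨-, L, rfl, e, S, rfl⟩ := h
  rw [Units.conj_pow, Matrix.rank_mul_eq_left_of_isUnit_det _ _
      ((Matrix.isUnit_iff_isUnit_det _).1 (Units.isUnit _)),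
    Matrix.rank_mul_eq_right_of_isUnit_det _ _
      ((Matrix.isUnit_iff_isUnit_det _).1 (Units.isUnit _)),
    Fintype.card_congr e, ← rank_jordanMatrix_pow K L t]
  have : ((jordanMatrix K L).submatrix e e) ^ t = (jordanMatrix K L ^ t).submatrix e e := by
    induction t with
    | zero => simp
    | succ t ih => rw [pow_succ, ih, Matrix.submatrix_mul_equiv, pow_succ]
  rw [this, Matrix.rank_submatrix]
  simp

theorem exists_hasJordanType {ι K : Type*} [Fintype ι] [DecidableEq ι] [Field K]
    (A : Matrix ι ι K) (hA : IsNilpotent A) : ∃ P : Multiset ℕ, HasJordanType A P := by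
  obtain ⟨d, k, c, hc⟩ := exists_jordan_basis (Matrix.toLin' A)
    (by
      obtain ⟨N, hN⟩ := hA
      exact ⟨N, by rw [← Matrix.toLin'_pow, hN, map_zero]⟩)
  -- The module decomposition may contain zero summands, which must not become parts.
  let I := {i : Fin d // k i ≠ 0}
  let ε : Fin (Fintype.card I) ≃ I := (Fintype.equivFin I).symm
  let L : List ℕ := List.ofFn fun i => k (ε i)
  have hL : L.length = Fintype.card I := by simp [L]
  let ρ : Fin L.length ≃ I := (finCongr hL).trans ε
  have hget : ∀ i : Fin L.length, L.get i = k (ρ i) := by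
    intro i
    simp only [L, ρ, List.get_ofFn]
    rfl
  let σ : (Σ i : Fin L.length, Fin (L.get i)) ≃ Σ i : Fin d, Fin (k i) :=
    { toFun := fun x => ⟨(ρ x.1).1, Fin.cast (hget x.1) x.2⟩
      invFun := fun y => ⟨ρ.symm ⟨y.1, by have := y.2.2; omega⟩,
        Fin.cast (by rw [hget]; simp) y.2⟩
      left_inv := by
        rintro ⟨i, a⟩
        have h : ρ.symm ⟨(ρ i).1, by have h1 := a.2; have h2 := hget i; omega⟩ = i := by simp
        refine Sigma.ext h ?_
        simp only
        rw [Fin.heq_ext_iff (by rw [h])]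
        rfl
      right_inv := by
        rintro ⟨i, a⟩
        have h : (ρ (ρ.symm ⟨i, by have := a.2; omega⟩)).1 = i := by simp
        refine Sigma.ext h ?_
        simp only
        rw [Fin.heq_ext_iff (by rw [h])]
        rfl }
  let b := c.reindex σ.symm
  have hb : ∀ x, Matrix.toLin' A (b x) =
      if h : x.2.val = 0 then 0 else b ⟨x.1, ⟨x.2.val - 1, by omega⟩⟩ := by
    intro x
    simp only [b, Module.Basis.reindex_apply, Equiv.symm_symm, hc]
    rfl
  have hcard : Fintype.card ι = Fintype.card (Σ i : Fin L.length, Fin (L.get i)) := by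
    rw [← Module.finrank_eq_card_basis b, Module.finrank_fintype_fun_eq_card]
  let e : ι ≃ Σ i : Fin L.length, Fin (L.get i) := Fintype.equivOfCardEq hcard
  let b' := b.reindex e.symm
  let T : Matrix ι ι K := (Pi.basisFun K ι).toMatrix b'
  have hT : ∀ i j, T i j = b (e j) i := by
    intro i j
    simp [T, Module.Basis.toMatrix_apply, b']
  let S : (Matrix ι ι K)ˣ := ⟨T, b'.toMatrix (Pi.basisFun K ι),
    Module.Basis.toMatrix_mul_toMatrix_flip _ _, Module.Basis.toMatrix_mul_toMatrix_flip _ _⟩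
  have hAT : A * T = T * (jordanMatrix K L).submatrix e e := by
    ext i j
    have h1 : (A * T) i j = Matrix.toLin' A (b (e j)) i := by
      rw [Matrix.mul_apply, Matrix.toLin'_apply, Matrix.mulVec, dotProduct]
      simp only [hT]
    rw [h1, hb, Matrix.mul_apply]
    simp only [hT, Matrix.submatrix_apply, jordanMatrix_apply]
    rw [Fintype.sum_equiv e _ (fun x => b x i *
      if x.1 = (e j).1 ∧ x.2.val + 1 = (e j).2.val then 1 else 0) fun _ => rfl]
    split_ifs with h
    · rw [Finset.sum_eq_zero]
      · rfl
      · intro x _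
        rw [if_neg, mul_zero]
        omega
    · rw [Finset.sum_eq_single ⟨(e j).1, ⟨(e j).2.val - 1, by omega⟩⟩]
      · rw [if_pos, mul_one]
        exact ⟨rfl, Nat.succ_pred_eq_of_ne_zero h⟩
      · rintro ⟨i', a⟩ - hne
        rw [if_neg, mul_zero]
        rintro ⟨h1, h2⟩
        simp only at h1 h2
        subst h1
        apply hne
        congr 1
        ext
        simp only
        omega
      · simp
  refine ⟨(L : Multiset ℕ), ?_, L, rfl, e, S, ?_⟩
  · simp only [Multiset.mem_coe, L, List.mem_ofFn, not_exists]
    intro i hi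
    exact (ε i).2 hi
  · have : A * (S : Matrix ι ι K) = S * (jordanMatrix K L).submatrix e e := hAT
    rw [← this, mul_assoc, Units.mul_inv, mul_one]

/-- The first difference in t counts the parts exceeding t, and the difference of these counts gives
the multiplicities. A part 0 would be invisible. -/
theorem multiset_eq_of_sum_min_eq {P P' : Multiset ℕ} (hP : 0 ∉ P) (hP' : 0 ∉ P')
    (h : ∀ t, (P.map (min t)).sum = (P'.map (min t)).sum) : P = P' := by
  have key : ∀ (P : Multiset ℕ) (t : ℕ),
      (P.map (min (t + 1))).sum = (P.map (min t)).sum + P.countP (t < ·) := by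
    intro P t
    induction P using Multiset.induction_on with
    | empty => simp
    | cons a P ih =>
      simp only [Multiset.map_cons, Multiset.sum_cons, ih, Multiset.countP_cons]
      split_ifs <;> omega
  have hc : ∀ t, P.countP (t < ·) = P'.countP (t < ·) := by
    intro t
    have h1 := key P t
    have h2 := key P' t
    have h3 := h t
    have h4 := h (t + 1)
    omega
  have key2 : ∀ (P : Multiset ℕ) (t : ℕ),
      P.countP (t < ·) = P.countP (t + 1 < ·) + P.count (t + 1) := by
    intro P t
    induction P using Multiset.induction_on with
    | empty => simp
    | cons a P ih =>
      simp only [Multiset.countP_cons, ih, Multiset.count_cons]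
      split_ifs <;> omega
  ext a
  rcases a with _ | a
  · rw [Multiset.count_eq_zero_of_notMem hP, Multiset.count_eq_zero_of_notMem hP']
  · have h1 := key2 P a
    have h2 := key2 P' a
    have h3 := hc a
    have h4 := hc (a + 1)
    omega

theorem hasJordanType_of_rank_pow {ι K : Type*} [Fintype ι] [DecidableEq ι] [Field K]
    {A : Matrix ι ι K} (hA : IsNilpotent A) {P : Multiset ℕ} (hP : 0 ∉ P)
    (h : ∀ t, (A ^ t).rank + (P.map (min t)).sum = Fintype.card ι) : HasJordanType A P := by
  obtain ⟨P', hP'⟩ := exists_hasJordanType A hA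
  have : P = P' := multiset_eq_of_sum_min_eq hP hP'.1 fun t => by
    have h1 := h t
    have h2 := hP'.rank_pow t
    omega
  rwa [this]

/-! ### Block Toeplitz matrices from 2×2 matrices of power series -/

section CommMat

variable {S : Type*} [CommRing S] {u s r : ℕ}

/-- The number of the block to which an index belongs. -/
def blockOf : Fin u ⊕ Fin s → Fin 2
  | Sum.inl _ => 0
  | Sum.inr _ => 1

/-- The position of an index in its block. -/
def posOf : Fin u ⊕ Fin s → ℕ
  | Sum.inl i => i
  | Sum.inr i => i

@[simp] theorem blockOf_inl (i : Fin u) : blockOf (Sum.inl i : Fin u ⊕ Fin s) = 0 := rfl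
@[simp] theorem blockOf_inr (i : Fin s) : blockOf (Sum.inr i : Fin u ⊕ Fin s) = 1 := rfl
@[simp] theorem posOf_inl (i : Fin u) : posOf (Sum.inl i : Fin u ⊕ Fin s) = i := rfl
@[simp] theorem posOf_inr (i : Fin s) : posOf (Sum.inr i : Fin u ⊕ Fin s) = i := rfl

/-- The row vector of the truncated coefficients of a pair of power series. -/
noncomputable def truncRow (u s : ℕ) (f : Fin 2 → PowerSeries S) : Fin u ⊕ Fin s → S :=
  fun y => PowerSeries.coeff (posOf y) (f (blockOf y))

/-- The block Toeplitz matrix of a `2 × 2` matrix of power series. -/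
noncomputable def commMat (u s : ℕ) (N : Matrix (Fin 2) (Fin 2) (PowerSeries S)) :
    Matrix (Fin u ⊕ Fin s) (Fin u ⊕ Fin s) S :=
  Matrix.of fun x => truncRow u s fun j => PowerSeries.X ^ posOf x * N (blockOf x) j

theorem commMat_apply (N : Matrix (Fin 2) (Fin 2) (PowerSeries S)) (x y : Fin u ⊕ Fin s) :
    commMat u s N x y
      = PowerSeries.coeff (posOf y) (PowerSeries.X ^ posOf x * N (blockOf x) (blockOf y)) := rfl

theorem commMat_map {S' : Type*} [CommRing S'] (φ : S →+* S')
    (N : Matrix (Fin 2) (Fin 2) (PowerSeries S)) :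
    (commMat u s N).map φ = commMat u s (N.map (PowerSeries.map φ)) := by
  ext x y
  simp only [Matrix.map_apply, commMat_apply, ← PowerSeries.coeff_map, map_mul, map_pow,
    PowerSeries.map_X]

theorem truncRow_surjective (v : Fin u ⊕ Fin s → S) : ∃ f, truncRow u s f = v := by
  refine ⟨![PowerSeries.mk fun n => if h : n < u then v (Sum.inl ⟨n, h⟩) else 0,
    PowerSeries.mk fun n => if h : n < s then v (Sum.inr ⟨n, h⟩) else 0], ?_⟩
  ext (i | i) <;> simp [truncRow]

theorem sum_coeff_mul_coeff_X_pow_mul (n j : ℕ) (f p : PowerSeries S)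
    (h : ∀ i, n ≤ i → i ≤ j → PowerSeries.coeff (j - i) p = 0) :
    ∑ i : Fin n, PowerSeries.coeff i f * PowerSeries.coeff j (PowerSeries.X ^ (i : ℕ) * p)
      = PowerSeries.coeff j (f * p) := by
  rw [Fin.sum_univ_eq_sum_range
    fun i => PowerSeries.coeff i f * PowerSeries.coeff j (PowerSeries.X ^ i * p),
    PowerSeries.coeff_mul, Finset.Nat.sum_antidiagonal_eq_sum_range_succ_mk]
  simp only [PowerSeries.coeff_X_pow_mul']
  have h1 : ∀ i ∈ Finset.range (max n (j + 1)), i ∉ Finset.range n →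
      PowerSeries.coeff i f * (if i ≤ j then PowerSeries.coeff (j - i) p else 0) = 0 := by
    intro i _ hi
    split_ifs with hij
    · rw [h i (by simpa using hi) hij, mul_zero]
    · rw [mul_zero]
  have h2 : ∀ i ∈ Finset.range (max n (j + 1)), i ∉ Finset.range (j + 1) →
      PowerSeries.coeff i f * (if i ≤ j then PowerSeries.coeff (j - i) p else 0) = 0 := by
    intro i _ hi
    rw [if_neg (by simpa [Nat.lt_succ_iff] using hi), mul_zero]
  rw [Finset.sum_subset (Finset.range_mono (le_max_left _ _)) h1,
    ← Finset.sum_subset (Finset.range_mono (le_max_right _ _)) h2]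
  refine Finset.sum_congr rfl fun i hi => ?_
  rw [if_pos (by simpa [Nat.lt_succ_iff] using hi)]

/-- Right multiplication by N must descend to pairs of series taken modulo X^u and X^s. Changing the
second series by X^s changes the first output by a multiple of X^s * N 1 0, which is 0 modulo X^u
since X^r divides N 1 0. -/
theorem truncRow_vecMul_commMat (hu : u = r + s) (f : Fin 2 → PowerSeries S)
    (N : Matrix (Fin 2) (Fin 2) (PowerSeries S)) (hN : PowerSeries.X ^ r ∣ N 1 0) :
    Matrix.vecMul (truncRow u s f) (commMat u s N) = truncRow u s (Matrix.vecMul f N) := by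
  ext y
  rw [Matrix.vecMul, dotProduct, Fintype.sum_sum_type]
  simp only [truncRow, commMat_apply, blockOf_inl, blockOf_inr, posOf_inl, posOf_inr]
  rw [Matrix.vecMul, dotProduct, Fin.sum_univ_two, map_add]
  congr 1
  · apply sum_coeff_mul_coeff_X_pow_mul
    intro i h1 h2
    rcases y with y | y <;> simp only [posOf_inl, posOf_inr] at h2 <;> omega
  · apply sum_coeff_mul_coeff_X_pow_mul
    intro i h1 h2
    rcases y with y | y <;> simp only [posOf_inl, posOf_inr, blockOf_inl] at h2 ⊢
    · exact PowerSeries.X_pow_dvd_iff.1 hN _ (by omega)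
    · omega

theorem commMat_mul (hu : u = r + s) (M N : Matrix (Fin 2) (Fin 2) (PowerSeries S))
    (hN : PowerSeries.X ^ r ∣ N 1 0) :
    commMat u s M * commMat u s N = commMat u s (M * N) := by
  ext x y
  have h := congrFun (truncRow_vecMul_commMat hu
    (fun j => PowerSeries.X ^ posOf x * M (blockOf x) j) N hN) y
  rw [commMat_apply, Matrix.mul_apply (M := M), Fin.sum_univ_two, mul_add, ← mul_assoc,
    ← mul_assoc]
  simp only [truncRow, Matrix.vecMul, dotProduct, Fin.sum_univ_two] at h
  exact h

theorem commMat_one : commMat u s (1 : Matrix (Fin 2) (Fin 2) (PowerSeries S)) = 1 := by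
  ext x y
  rw [commMat_apply, Matrix.one_apply]
  rcases x with x | x <;> rcases y with y | y <;>
    simp [PowerSeries.coeff_X_pow, Matrix.one_apply, Fin.ext_iff, eq_comm]

theorem commMat_pow (hu : u = r + s) (N : Matrix (Fin 2) (Fin 2) (PowerSeries S))
    (hN : PowerSeries.X ^ r ∣ N 1 0) (i : ℕ) :
    commMat u s N ^ i = commMat u s (N ^ i) := by
  induction i with
  | zero => rw [pow_zero, pow_zero, commMat_one]
  | succ i ih => rw [pow_succ, ih, commMat_mul hu _ _ hN, pow_succ]

theorem commMat_eq_zero (N : Matrix (Fin 2) (Fin 2) (PowerSeries S))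
    (h : ∀ i, PowerSeries.X ^ u ∣ N i 0 ∧ PowerSeries.X ^ s ∣ N i 1) : commMat u s N = 0 := by
  ext x y
  rw [commMat_apply, Matrix.zero_apply]
  rcases y with y | y
  · exact PowerSeries.X_pow_dvd_iff.1 (Dvd.dvd.mul_left (h _).1 _) _ y.2
  · exact PowerSeries.X_pow_dvd_iff.1 (Dvd.dvd.mul_left (h _).2 _) _ y.2

/-- Divisibility of the entries of the powers of a `2 × 2` matrix by powers of the variable. -/
theorem X_pow_dvd_pow_entries {N : Matrix (Fin 2) (Fin 2) (PowerSeries S)} {k m : ℕ}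
    (hmk : m ≤ k) (hmr : 2 * m ≤ r) (h00 : PowerSeries.X ^ k ∣ N 0 0)
    (h10 : PowerSeries.X ^ r ∣ N 1 0) (h11 : PowerSeries.X ^ m ∣ N 1 1) (i : ℕ) :
    PowerSeries.X ^ min ((i + 1) * k) (r - 2 * m + (i + 1) * m) ∣ (N ^ (i + 1)) 0 0 ∧
    PowerSeries.X ^ (i * m) ∣ (N ^ (i + 1)) 0 1 ∧
    PowerSeries.X ^ (r + i * m) ∣ (N ^ (i + 1)) 1 0 ∧
    PowerSeries.X ^ ((i + 1) * m) ∣ (N ^ (i + 1)) 1 1 := by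
  have key : ∀ {a b c : ℕ} {f g : PowerSeries S}, PowerSeries.X ^ a ∣ f → PowerSeries.X ^ b ∣ g →
      c ≤ a + b → PowerSeries.X ^ c ∣ f * g := fun hf hg hc =>
    (pow_dvd_pow _ hc).trans (by rw [pow_add]; exact mul_dvd_mul hf hg)
  have triv : PowerSeries.X ^ 0 ∣ N 0 1 := by simp
  -- An entry of a power is a sum over walks on two vertices with loops of order at least k and m,
  -- where a step from 1 to 0 costs r. A closed walk at 0 of length t ≥ 2 costs at least tk (never
  -- leaving) or r + (t-2)m (one excursion); by m ≤ k and 2m ≤ r other walks are no cheaper than the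
  -- excursion.
  induction i with
  | zero =>
    simp only [zero_add, pow_one, one_mul, zero_mul, add_zero]
    exact ⟨(pow_dvd_pow _ (min_le_left _ _)).trans h00, triv, h10, h11⟩
  | succ i ih =>
    obtain ⟨i00, i01, i10, i11⟩ := ih
    have e1 : (i + 1 + 1) * k = (i + 1) * k + k := by ring
    have e2 : (i + 1 + 1) * m = (i + 1) * m + m := by ring
    have e3 : (i + 1) * m = i * m + m := by ring
    have e4 : (i + 1) * m ≤ (i + 1) * k := Nat.mul_le_mul_left _ hmk
    simp only [pow_succ N (i + 1), Matrix.mul_apply, Fin.sum_univ_two]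
    refine ⟨dvd_add (key i00 h00 ?_) (key i01 h10 ?_), dvd_add (key i00 triv ?_) (key i01 h11 ?_),
      dvd_add (key i10 h00 ?_) (key i11 h10 ?_), dvd_add (key i10 triv ?_) (key i11 h11 ?_)⟩ <;>
    omega

end CommMat

/-! ### The nilpotent commutator as a set of symbols -/

section Commutator

variable {K : Type*} [Field K] {u r : ℕ}

theorem jordanQ_eq_commMat :
    jordanQ K u r = commMat u (u - r) ((PowerSeries.X : PowerSeries K) • 1) := by
  ext x y
  rw [commMat_apply]
  rcases x with x | x <;> rcases y with y | y <;>
    simp [jordanQ, jordanBlock, ← pow_succ, PowerSeries.coeff_X_pow, eq_comm]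

/-- The `2 × 2` matrix of power series with the given entries. -/
noncomputable def symbolMat {S : Type*} [CommRing S] (r : ℕ) (a g h b : PowerSeries S) :
    Matrix (Fin 2) (Fin 2) (PowerSeries S) :=
  !![a, g; PowerSeries.X ^ r * h, b]

theorem commMat_mem_nilCommutator (hr : 2 ≤ r) (hu : r < u)
    (N : Matrix (Fin 2) (Fin 2) (PowerSeries K)) (h00 : PowerSeries.X ∣ N 0 0)
    (h10 : PowerSeries.X ^ r ∣ N 1 0) (h11 : PowerSeries.X ∣ N 1 1) :
    commMat u (u - r) N ∈ nilCommutator K u r := by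
  have hus : u = r + (u - r) := by omega
  constructor
  · refine ⟨u + 1, ?_⟩
    rw [commMat_pow hus N h10]
    apply commMat_eq_zero
    -- With k = m = 1 each further factor raises the order of every bound by one, so the (u+1)-st
    -- power is truncated to zero.
    obtain ⟨i00, i01, i10, i11⟩ := X_pow_dvd_pow_entries (k := 1) (m := 1) le_rfl
      (by omega) (by simpa using h00) h10 (by simpa using h11) u
    intro i
    fin_cases i
    · exact ⟨(pow_dvd_pow _ (by omega)).trans i00, (pow_dvd_pow _ (by omega)).trans i01⟩
    · exact ⟨(pow_dvd_pow _ (by omega)).trans i10, (pow_dvd_pow _ (by omega)).trans i11⟩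
  · rw [jordanQ_eq_commMat, Commute, SemiconjBy, commMat_mul hus _ _ (by simp),
      commMat_mul hus _ _ h10]
    simp

theorem constantCoeff_pow_of_upperTriangular (N : Matrix (Fin 2) (Fin 2) (PowerSeries K))
    (h : PowerSeries.constantCoeff (N 1 0) = 0) (n : ℕ) :
    PowerSeries.constantCoeff ((N ^ n) 1 0) = 0 ∧
    PowerSeries.constantCoeff ((N ^ n) 0 0) = PowerSeries.constantCoeff (N 0 0) ^ n ∧
    PowerSeries.constantCoeff ((N ^ n) 1 1) = PowerSeries.constantCoeff (N 1 1) ^ n := by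
  induction n with
  | zero => simp
  | succ n ih =>
    simp [pow_succ, Matrix.mul_apply, Fin.sum_univ_two, ih, h]

theorem vecMul_jordanQ_pow (hr : r ≤ u) (f : Fin 2 → PowerSeries K) (i : ℕ) :
    Matrix.vecMul (truncRow u (u - r) f) (jordanQ K u r ^ i)
      = truncRow u (u - r) fun j => PowerSeries.X ^ i * f j := by
  have hus : u = r + (u - r) := by omega
  rw [jordanQ_eq_commMat, commMat_pow hus _ (by simp), smul_pow, one_pow,
    truncRow_vecMul_commMat hus _ _ (by simp)]
  congr 1
  ext1 j
  simp [Matrix.vecMul_smul]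

theorem row_of_commute_jordanQ (hr : r ≤ u) {A : Matrix (Fin u ⊕ Fin (u - r)) (Fin u ⊕ Fin (u - r)) K}
    (hA : Commute A (jordanQ K u r)) (f ρ : Fin 2 → PowerSeries K)
    (hf : Matrix.vecMul (truncRow u (u - r) f) A = truncRow u (u - r) ρ) (i : ℕ) :
    Matrix.vecMul (truncRow u (u - r) fun j => PowerSeries.X ^ i * f j) A
      = truncRow u (u - r) fun j => PowerSeries.X ^ i * ρ j := by
  rw [← vecMul_jordanQ_pow hr, Matrix.vecMul_vecMul, ← (hA.pow_right i).eq,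
    ← Matrix.vecMul_vecMul, hf, vecMul_jordanQ_pow hr]

theorem truncRow_single (x : Fin u ⊕ Fin (u - r)) :
    truncRow u (u - r) (fun j => PowerSeries.X ^ posOf x * (Pi.single (blockOf x) 1 : Fin 2 → PowerSeries K) j)
      = Pi.single x 1 := by
  ext y
  rcases x with x | x <;> rcases y with y | y <;>
    simp [truncRow, PowerSeries.coeff_X_pow, Pi.single_apply, Fin.ext_iff]

/-- Commuting with J_Q is K[X]-linearity, so the images of the two generators, that is the first
rows of the blocks, determine A. Nilpotency then kills the constant terms on the diagonal, since
modulo X the symbol is triangular. -/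
theorem eq_commMat_of_mem_nilCommutator (hr : 2 ≤ r) (hu : r < u)
    {A : Matrix (Fin u ⊕ Fin (u - r)) (Fin u ⊕ Fin (u - r)) K} (hA : A ∈ nilCommutator K u r) :
    A = commMat u (u - r) (symbolMat r (PowerSeries.mk (coordA A)) (PowerSeries.mk (coordG A))
        (PowerSeries.mk (coordH A)) (PowerSeries.mk (coordB A))) ∧
      coordA A 0 = 0 ∧ coordB A 0 = 0 := by
  obtain ⟨hnil, hcomm⟩ := hA
  have hus : u = r + (u - r) := by omega
  let x₀ : Fin u ⊕ Fin (u - r) := Sum.inl ⟨0, by omega⟩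
  let x₁ : Fin u ⊕ Fin (u - r) := Sum.inr ⟨0, by omega⟩
  obtain ⟨ρ₁, hρ₁⟩ := truncRow_surjective (S := K) (A x₁)
  have row : ∀ (x : Fin u ⊕ Fin (u - r)) (ρ : Fin 2 → PowerSeries K), posOf x = 0 →
      A x = truncRow u (u - r) ρ → ∀ i,
      Matrix.vecMul (truncRow u (u - r)
        fun j => PowerSeries.X ^ i * (Pi.single (blockOf x) 1 : Fin 2 → PowerSeries K) j) A
      = truncRow u (u - r) fun j => PowerSeries.X ^ i * ρ j := by
    intro x ρ h0 hx i
    apply row_of_commute_jordanQ hu.le hcomm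
    have := truncRow_single (K := K) x
    rw [h0] at this
    simp only [pow_zero, one_mul] at this
    rw [this, Matrix.single_one_vecMul]
    exact hx
  -- X^(u-r) annihilates the second generator, so X^(u-r) times its image is 0 modulo X^u.
  have hlow : ∀ j < r, PowerSeries.coeff j (ρ₁ 0) = 0 := by
    intro j hj
    have h1 := row x₁ ρ₁ rfl hρ₁.symm (u - r)
    have h2 : (truncRow u (u - r) fun j => PowerSeries.X ^ (u - r) *
        (Pi.single (blockOf x₁) 1 : Fin 2 → PowerSeries K) j) = 0 := by
      ext (y | y)
      · simp [truncRow, x₁]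
      · simp [truncRow, x₁, PowerSeries.coeff_X_pow, y.2.ne]
    rw [h2, Matrix.zero_vecMul] at h1
    have h3 := congrFun h1 (Sum.inl ⟨u - r + j, by omega⟩)
    simpa [truncRow, PowerSeries.coeff_X_pow_mul'] using h3.symm
  set N := symbolMat r (PowerSeries.mk (coordA A)) (PowerSeries.mk (coordG A))
        (PowerSeries.mk (coordH A)) (PowerSeries.mk (coordB A)) with hN
  have hrow₀ : A x₀ = truncRow u (u - r) (N 0) := by
    ext (y | y) <;> simp [truncRow, hN, symbolMat, coordA, coordG, x₀]
  have hrow₁ : A x₁ = truncRow u (u - r) (N 1) := by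
    ext (y | y)
    · simp only [truncRow, hN, symbolMat, posOf_inl, blockOf_inl, Matrix.of_apply,
        Matrix.cons_val', Matrix.cons_val_zero, Matrix.cons_val_one, PowerSeries.coeff_X_pow_mul',
        PowerSeries.coeff_mk, coordH]
      by_cases hy : r ≤ y.val
      · rw [if_pos hy, dif_pos (show y.val - r < u - r by omega)]
        congr 2
        ext
        exact (Nat.add_sub_cancel' hy).symm
      · rw [if_neg hy, ← hρ₁]
        exact hlow _ (lt_of_not_ge hy)
    · simp [truncRow, hN, symbolMat, coordB, x₁]
  have hAN : A = commMat u (u - r) N := by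
    ext x y
    have h1 : A x = Matrix.vecMul (Pi.single x 1) A := (Matrix.single_one_vecMul x A).symm
    rw [h1, ← truncRow_single, commMat]
    rcases x with x | x
    · exact congrFun (row x₀ _ rfl hrow₀ x.val) y
    · exact congrFun (row x₁ _ rfl hrow₁ x.val) y
  refine ⟨hAN, ?_⟩
  obtain ⟨n, hn⟩ := hnil
  have h10 : PowerSeries.X ^ r ∣ N 1 0 := by simp [hN, symbolMat]
  obtain ⟨-, c0, c1⟩ := constantCoeff_pow_of_upperTriangular N
    (PowerSeries.X_dvd_iff.1 ((dvd_pow_self _ (by omega)).trans h10)) n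
  rw [hAN, commMat_pow hus N h10] at hn
  have e0 := congrFun (congrFun hn x₀) x₀
  have e1 := congrFun (congrFun hn x₁) x₁
  simp only [commMat_apply, x₀, x₁, posOf_inl, posOf_inr, blockOf_inl, blockOf_inr, pow_zero,
    one_mul, Matrix.zero_apply, PowerSeries.coeff_zero_eq_constantCoeff_apply] at e0 e1
  rw [c0] at e0
  rw [c1] at e1
  have f0 := eq_zero_of_pow_eq_zero e0
  have f1 := eq_zero_of_pow_eq_zero e1
  rw [← PowerSeries.coeff_zero_eq_constantCoeff_apply] at f0 f1
  simpa [hN, symbolMat] using And.intro f0 f1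

end Commutator

/-! ### Rank bounds for products and for block Toeplitz matrices -/

/-- Sylvester's inequality: the kernel of A restricted to the image of B lies in the kernel of A. -/
theorem Matrix.rank_add_rank_le_card_add_rank_mul {ι K : Type*} [Fintype ι] [Field K]
    (A B : Matrix ι ι K) : A.rank + B.rank ≤ Fintype.card ι + (A * B).rank := by
  let g := A.mulVecLin.domRestrict (LinearMap.range B.mulVecLin)
  have h1 := g.finrank_range_add_finrank_ker
  have h2 := A.mulVecLin.finrank_range_add_finrank_ker
  have h3 : Module.finrank K (LinearMap.ker g) ≤ Module.finrank K (LinearMap.ker A.mulVecLin) := by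
    refine LinearMap.finrank_le_finrank_of_injective
      (f := LinearMap.codRestrict (LinearMap.ker A.mulVecLin)
        ((LinearMap.range B.mulVecLin).subtype.comp (LinearMap.ker g).subtype)
        fun x => x.2) ?_
    intro x y hxy
    apply Subtype.ext
    apply Subtype.ext
    exact congrArg (Subtype.val : LinearMap.ker A.mulVecLin → ι → K) hxy
  have h4 : LinearMap.range g = LinearMap.range (A * B).mulVecLin := by
    rw [Matrix.mulVecLin_mul, LinearMap.range_comp]
    exact LinearMap.range_domRestrict _ _
  rw [h4] at h1
  rw [Module.finrank_fintype_fun_eq_card] at h2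
  simp only [Matrix.rank]
  omega

theorem Matrix.card_le_rank_pow_add_mul {ι K : Type*} [Fintype ι] [DecidableEq ι] [Field K]
    {A : Matrix ι ι K} {c : ℕ} (h : Fintype.card ι ≤ A.rank + c) (i : ℕ) :
    Fintype.card ι ≤ (A ^ i).rank + i * c := by
  induction i with
  | zero => simp [Matrix.rank_one]
  | succ i ih =>
    have := Matrix.rank_add_rank_le_card_add_rank_mul (A ^ i) A
    rw [← pow_succ] at this
    have e : (i + 1) * c = i * c + c := by ring
    omega

section Rank

variable {K : Type*} [Field K] {u s r : ℕ}

/-- The corank is at least min(D, s + e). After elimination with the pivot X^e p, the second column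
retains a factor X^(D-e) from the determinant; hence a vector of the row space is determined by its
coordinates from e on in the first block and from D - e on in the second. -/
theorem rank_commMat_le (hu : u = r + s) {M : Matrix (Fin 2) (Fin 2) (PowerSeries K)} {e D : ℕ}
    {p : PowerSeries K} (hp : PowerSeries.constantCoeff p ≠ 0)
    (h00 : M 0 0 = PowerSeries.X ^ e * p) (h10 : PowerSeries.X ^ e ∣ M 1 0)
    (hr10 : PowerSeries.X ^ r ∣ M 1 0) (h01 : PowerSeries.X ^ (e - r) ∣ M 0 1)
    (hdet : PowerSeries.X ^ D ∣ M.det) (heu : e ≤ u) (heD : e ≤ D) :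
    (commMat u s M).rank ≤ (u - e) + (s - (D - e)) := by
  classical
  have hX : ∀ n, (PowerSeries.X : PowerSeries K) ^ n ≠ 0 :=
    fun n => pow_ne_zero _ PowerSeries.X_ne_zero
  obtain ⟨t, ht⟩ := h10
  have hdet' : PowerSeries.X ^ (D - e) ∣ p * M 1 1 - M 0 1 * t := by
    have h1 : M.det = PowerSeries.X ^ e * (p * M 1 1 - M 0 1 * t) := by
      rw [Matrix.det_fin_two, h00, ht]; ring
    rw [h1, ← Nat.add_sub_cancel' heD, pow_add] at hdet
    simpa using (mul_dvd_mul_iff_left (hX e)).1 hdet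
  let T : Finset (Fin u ⊕ Fin s) :=
    (Finset.univ.filter fun i : Fin u => e ≤ i.val).disjSum
      (Finset.univ.filter fun i : Fin s => D - e ≤ i.val)
  have hT : T.card = (u - e) + (s - (D - e)) := by
    rw [Finset.card_disjSum]
    have hc : ∀ n c : ℕ, (Finset.univ.filter fun i : Fin n => c ≤ i.val).card = n - c := by
      intro n c
      have h1 := Finset.card_filter_add_card_filter_not (s := (Finset.univ : Finset (Fin n)))
        (fun i => i.val < c)
      rw [Fin.card_filter_val_lt, Finset.card_univ, Fintype.card_fin] at h1
      simp only [not_lt] at h1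
      omega
    rw [hc, hc]
  rw [← hT, ← Matrix.rank_transpose, Matrix.rank]
  apply finrank_le_card_of_coords
  rintro _ ⟨v, rfl⟩ hw
  rw [Matrix.mulVecLin_apply, Matrix.mulVec_transpose] at hw ⊢
  obtain ⟨f, rfl⟩ := truncRow_surjective v
  rw [truncRow_vecMul_commMat hu f M hr10] at hw ⊢
  set w := Matrix.vecMul f M with hwdef
  have hw0 : w 0 = PowerSeries.X ^ e * (f 0 * p + f 1 * t) := by
    rw [hwdef, Matrix.vecMul, dotProduct, Fin.sum_univ_two, h00, ht]; ring
  have hw1 : w 1 = f 0 * M 0 1 + f 1 * M 1 1 := by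
    rw [hwdef, Matrix.vecMul, dotProduct, Fin.sum_univ_two]
  have hd0 : PowerSeries.X ^ u ∣ w 0 := by
    rw [PowerSeries.X_pow_dvd_iff]
    intro j hj
    by_cases hje : e ≤ j
    · exact hw (Sum.inl ⟨j, hj⟩) (by simp [T, hje])
    · rw [hw0]
      exact PowerSeries.X_pow_dvd_iff.1 (dvd_mul_right _ _) _ (by omega)
  have hc : PowerSeries.X ^ (u - e) ∣ f 0 * p + f 1 * t := by
    rw [hw0, ← Nat.add_sub_cancel' heu, pow_add] at hd0
    simpa using (mul_dvd_mul_iff_left (hX e)).1 hd0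
  have hd1 : PowerSeries.X ^ min s (D - e) ∣ w 1 := by
    -- The first term is divisible by X^((e-r)+(u-e)), with exponent at least s; the second carries
    -- X^(D-e).
    have hp' : p * w 1 = M 0 1 * (f 0 * p + f 1 * t) + f 1 * (p * M 1 1 - M 0 1 * t) := by
      rw [hw1]; ring
    have h2 : PowerSeries.X ^ min s (D - e) ∣ p * w 1 := by
      rw [hp']
      refine dvd_add ?_ (((pow_dvd_pow _ (min_le_right _ _)).trans hdet').mul_left _)
      refine (pow_dvd_pow _ (show min s (D - e) ≤ (e - r) + (u - e) by omega)).trans ?_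
      rw [pow_add]
      exact mul_dvd_mul h01 hc
    have hunit : IsUnit p := by
      rw [PowerSeries.isUnit_iff_constantCoeff]
      exact hp.isUnit
    exact hunit.dvd_mul_left.1 h2
  ext (y | y)
  · exact PowerSeries.X_pow_dvd_iff.1 hd0 _ y.2
  · by_cases hy : D - e ≤ y.val
    · exact hw (Sum.inr y) (by simp [T]; omega)
    · exact PowerSeries.X_pow_dvd_iff.1 hd1 _ (by have := y.2; simp only [posOf_inr]; omega)

/-- The upper left block contains a triangular Toeplitz minor of size u - e with the constant term
of p on its diagonal. -/
theorem le_rank_commMat {M : Matrix (Fin 2) (Fin 2) (PowerSeries K)} {e : ℕ}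
    {p : PowerSeries K} (hp : PowerSeries.constantCoeff p ≠ 0)
    (h00 : M 0 0 = PowerSeries.X ^ e * p) : u - e ≤ (commMat u s M).rank := by
  have h := card_le_rank_of_det_submatrix_ne_zero (commMat u s M)
    (fun i : Fin (u - e) => Sum.inl ⟨i.val, by omega⟩)
    (fun i : Fin (u - e) => Sum.inl ⟨i.val + e, by omega⟩) ?_
  · simpa using h
  have hentry : ∀ i j : Fin (u - e), ((commMat u s M).submatrix
      (fun i : Fin (u - e) => Sum.inl ⟨i.val, by omega⟩)
      (fun i : Fin (u - e) => Sum.inl ⟨i.val + e, by omega⟩)) i j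
      = if i ≤ j then PowerSeries.coeff (j.val - i.val) p else 0 := by
    intro i j
    simp only [Matrix.submatrix_apply, commMat_apply, posOf_inl, blockOf_inl, h00]
    rw [mul_left_comm, PowerSeries.coeff_X_pow_mul, PowerSeries.coeff_X_pow_mul']
    rfl
  rw [Matrix.det_of_isUpperTriangular]
  · apply Finset.prod_ne_zero_iff.2
    intro i _
    rw [hentry, if_pos le_rfl, Nat.sub_self, PowerSeries.coeff_zero_eq_constantCoeff_apply]
    exact hp
  · intro i j hij
    rw [hentry]
    exact if_neg (not_le.2 hij)

end Rank

/-! ### The equations in terms of symbols -/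

section Locus

variable {K : Type*} [Field K] {u r k l : ℕ}

theorem coordA_commMat (N : Matrix (Fin 2) (Fin 2) (PowerSeries K)) {i : ℕ} (hi : i < u) :
    coordA (commMat u (u - r) N) i = PowerSeries.coeff i (N 0 0) := by
  simp [coordA, hi, commMat_apply]

theorem coordB_commMat (N : Matrix (Fin 2) (Fin 2) (PowerSeries K)) {i : ℕ} (hi : i < u - r) :
    coordB (commMat u (u - r) N) i = PowerSeries.coeff i (N 1 1) := by
  simp [coordB, hi, commMat_apply]

theorem coordG_commMat (N : Matrix (Fin 2) (Fin 2) (PowerSeries K)) {i : ℕ} (hi : i < u - r) :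
    coordG (commMat u (u - r) N) i = PowerSeries.coeff i (N 0 1) := by
  simp [coordG, hi, commMat_apply]

theorem coordH_commMat (N : Matrix (Fin 2) (Fin 2) (PowerSeries K)) {i : ℕ} (hi : i < u - r) :
    coordH (commMat u (u - r) N) i = PowerSeries.coeff (r + i) (N 1 0) := by
  simp [coordH, hi, commMat_apply]

theorem mk_eq_X_pow_mul_mk {c : ℕ → K} {n : ℕ} (h : ∀ i < n, c i = 0) :
    PowerSeries.mk c = PowerSeries.X ^ n * PowerSeries.mk fun i => c (n + i) := by
  ext i
  rw [PowerSeries.coeff_X_pow_mul', PowerSeries.coeff_mk]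
  split_ifs with hi
  · rw [PowerSeries.coeff_mk, Nat.add_sub_cancel' hi]
  · exact h _ (by omega)

theorem coeff_mul_sub_mul (α β γ η : PowerSeries K) (m : ℕ) :
    PowerSeries.coeff m (α * β - γ * η) = ∑ j ∈ Finset.range (m + 1),
      (PowerSeries.coeff j α * PowerSeries.coeff (m - j) β
        - PowerSeries.coeff j γ * PowerSeries.coeff (m - j) η) := by
  rw [map_sub, PowerSeries.coeff_mul, PowerSeries.coeff_mul,
    Finset.Nat.sum_antidiagonal_eq_sum_range_succ_mk,
    Finset.Nat.sum_antidiagonal_eq_sum_range_succ_mk, Finset.sum_sub_distrib]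

/-- The quadratic equations are the vanishing of the coefficients of αβ - γη below degree k+l-r.
Truncated subtraction makes this vacuous for k+l ≤ r, and min(l, r-k) merges the two cases of the
linear equations; a_0 = b_0 = 0 comes from nilpotency. -/
theorem mem_locusX_iff (hr : 2 ≤ r) (hu : r < u) (hk1 : 1 ≤ k) (hk : k ≤ r - 1) (hl1 : 1 ≤ l)
    (hl : l ≤ u - r) (A : Matrix (Fin u ⊕ Fin (u - r)) (Fin u ⊕ Fin (u - r)) K) :
    A ∈ locusX K u r k l ↔ ∃ α β γ η : PowerSeries K,
      PowerSeries.X ^ (k + l - r) ∣ α * β - γ * η ∧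
      A = commMat u (u - r) (symbolMat r (PowerSeries.X ^ k * α) γ η
        (PowerSeries.X ^ min l (r - k) * β)) := by
  constructor
  · rintro ⟨hA, hE⟩
    obtain ⟨hAN, ha0, hb0⟩ := eq_commMat_of_mem_nilCommutator hr hu hA
    have ha : ∀ i < k, coordA A i = 0 := by
      intro i hi
      rcases Nat.eq_zero_or_pos i with rfl | hpos
      · exact ha0
      · unfold SatisfiesE at hE
        split_ifs at hE
        · exact hE.1 i hpos hi
        · exact hE.1 i hpos hi
    have hb : ∀ i < min l (r - k), coordB A i = 0 := by
      intro i hi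
      rcases Nat.eq_zero_or_pos i with rfl | hpos
      · exact hb0
      · unfold SatisfiesE at hE
        split_ifs at hE
        · exact hE.2 i hpos (by omega)
        · exact hE.2.1 i hpos (by omega)
    rw [mk_eq_X_pow_mul_mk ha, mk_eq_X_pow_mul_mk hb] at hAN
    refine ⟨_, _, _, _, ?_, hAN⟩
    rw [PowerSeries.X_pow_dvd_iff]
    intro m hm
    unfold SatisfiesE at hE
    rw [if_neg (by omega)] at hE
    rw [coeff_mul_sub_mul, ← hE.2.2 m hm]
    simp only [PowerSeries.coeff_mk, show min l (r - k) = r - k by omega]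
  · rintro ⟨α, β, γ, η, h, rfl⟩
    have hmin : 1 ≤ min l (r - k) := by omega
    set N := symbolMat r (PowerSeries.X ^ k * α) γ η (PowerSeries.X ^ min l (r - k) * β) with hN
    have h00 : PowerSeries.X ^ k ∣ N 0 0 := by simp [hN, symbolMat]
    have h11 : PowerSeries.X ^ min l (r - k) ∣ N 1 1 := by simp [hN, symbolMat]
    refine ⟨commMat_mem_nilCommutator hr hu N ((dvd_pow_self _ (by omega)).trans h00)
      (by simp [hN, symbolMat]) ((dvd_pow_self _ (by omega)).trans h11), ?_⟩
    have ha : ∀ i, 1 ≤ i → i < k → coordA (commMat u (u - r) N) i = 0 := fun i _ hi => by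
      rw [coordA_commMat N (by omega)]
      exact PowerSeries.X_pow_dvd_iff.1 h00 i hi
    have hb : ∀ i, i < min l (r - k) → coordB (commMat u (u - r) N) i = 0 := fun i hi => by
      rw [coordB_commMat N (by omega)]
      exact PowerSeries.X_pow_dvd_iff.1 h11 i hi
    unfold SatisfiesE
    split_ifs with hkl
    · exact ⟨ha, fun i _ hi => hb i (by omega)⟩
    · refine ⟨ha, fun i _ hi => hb i (by omega), fun m hm => ?_⟩
      rw [← PowerSeries.X_pow_dvd_iff.1 h m hm, coeff_mul_sub_mul]
      refine Finset.sum_congr rfl fun j hj => ?_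
      rw [Finset.mem_range] at hj
      have hmin' : min l (r - k) = r - k := by omega
      rw [coordA_commMat N (by omega), coordB_commMat N (by omega), coordG_commMat N (by omega),
        coordH_commMat N (by omega)]
      simp only [hN, symbolMat, hmin', Matrix.of_apply, Matrix.cons_val', Matrix.cons_val_zero,
        Matrix.cons_val_one, Matrix.cons_val_fin_one]
      rw [add_comm k j, add_comm (r - k), add_comm r, PowerSeries.coeff_X_pow_mul,
        PowerSeries.coeff_X_pow_mul, PowerSeries.coeff_X_pow_mul]

end Locus

/-! ### Arithmetic of the table -/

section Table

/-- The parts lie in {q, q+1} with q = n / p, so t is either at most all of them or at least all of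
them. -/
theorem sum_map_min_almostRect {n p : ℕ} (hp : 1 ≤ p) (t : ℕ) :
    ((almostRect n p).map (min t)).sum = min (t * p) n := by
  have h1 := Nat.div_add_mod n p
  have h2 := Nat.mod_lt n hp
  simp only [almostRect, Multiset.map_add, Multiset.map_replicate, Multiset.sum_add,
    Multiset.sum_replicate, smul_eq_mul]
  generalize n % p = c at *
  generalize n / p = q at *
  obtain ⟨e, rfl⟩ : ∃ e, p = c + e := ⟨p - c, by omega⟩
  rw [Nat.add_sub_cancel_left]
  subst h1
  rcases le_or_gt t q with h | h
  · rw [min_eq_left (by omega), min_eq_left h, min_eq_left]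
    · ring
    · nlinarith
  · rw [min_eq_right (by omega), min_eq_right (by omega), min_eq_right]
    · ring
    · nlinarith

theorem zero_notMem_almostRect {n p : ℕ} (hp : 1 ≤ p) (hpn : p ≤ n) : 0 ∉ almostRect n p := by
  have := Nat.div_pos hpn hp
  intro h
  rcases Multiset.mem_add.1 h with h | h
  · have := Multiset.eq_of_mem_replicate h
    omega
  · have := Multiset.eq_of_mem_replicate h
    omega

/-- The generic order of the upper left entry of the `t`-th power. -/
def genericOrder (r k l t : ℕ) : ℕ :=
  min (t * k) (r - 2 * min k (min l (r - k)) + t * min k (min l (r - k)))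

/-- The generic corank of the `t`-th power. -/
def genericCorank (u r k l t : ℕ) : ℕ :=
  min (t * (k + l)) (min (u - r + genericOrder r k l t) (u + (u - r)))

variable {u r k l : ℕ}

theorem tableQ_spec {τ : ℕ} (hτ : 1 ≤ τ) (hu : r < u) :
    u - r ≤ τ * tableQ u r τ ∧ τ * (tableQ u r τ - 1) < u - r ∧ 1 ≤ tableQ u r τ := by
  have h1 : ∀ c, tableQ u r τ ≤ c ↔ u - r ≤ τ * c := fun c =>
    ceilDiv_le_iff_le_mul hτ
  have h2 := (h1 _).1 le_rfl
  have h3 : 1 ≤ tableQ u r τ := by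
    by_contra h
    have : tableQ u r τ = 0 := by omega
    rw [this] at h2
    omega
  refine ⟨h2, ?_, h3⟩
  by_contra h
  have := (h1 (tableQ u r τ - 1)).2 (by omega)
  omega

theorem lt_tableK_iff {τ : ℕ} (hτ : 1 ≤ τ) :
    k < tableK u r τ ↔ (k - τ) * (tableQ u r τ + 1) ≤ r - 2 * τ := by
  rw [tableK, if_neg (by omega), ← Nat.le_div_iff_mul_le (by omega)]
  generalize (r - 2 * τ) / (tableQ u r τ + 1) = D
  omega

theorem tableC_le_iff {τ : ℕ} (hτ : 1 ≤ τ) (hu : r < u) (hrτ : 2 * τ < r) :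
    (tableD u r τ = 0 → (tableC u r τ ≤ k ↔ r - 2 * τ < (k - τ) * (tableQ u r τ + 1))) ∧
    (tableD u r τ ≠ 0 → (tableC u r τ ≤ k ↔ r - 2 * τ ≤ (k - τ) * tableQ u r τ)) := by
  obtain ⟨-, -, hq⟩ := tableQ_spec hτ hu
  refine ⟨fun h => ?_, fun h => ?_⟩
  · rw [tableC, if_pos h, ← not_lt, lt_tableK_iff hτ, not_le]
  · have hpos : 1 ≤ (r - 2 * τ) ⌈/⌉ tableQ u r τ := by
      by_contra h0
      have := (ceilDiv_le_iff_le_mul (b := r - 2 * τ) (c := 0) hq).1 (by omega)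
      omega
    rw [tableC, if_neg h, mul_comm (k - τ), ← ceilDiv_le_iff_le_mul hq]
    omega

theorem sum_min_typeA_of_le (hu : r < u) (h1 : k ≤ l) (h2 : k ≤ r - k) (t : ℕ) :
    min (t * k) u + min (t * l) (u - r) = genericCorank u r k l t := by
  have hm : min k (min l (r - k)) = k := by omega
  rw [genericCorank, genericOrder, hm, mul_add]
  have : t * k ≤ t * l := Nat.mul_le_mul_left _ h1
  omega

/-- In the case not covered by `sum_min_typeA_of_le`, m = l < k. For t ≤ q+1 the bound on k gives
e_t = tk; for t ≥ q+2 the excursion term r - 2l + tl is already at least u. Either way the corank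
splits into the contributions of the two blocks. -/
theorem sum_min_typeA (hu : r < u) {τ : ℕ} (hτ : 1 ≤ τ) (hrτ : 2 * τ < r) (hτl : τ ≤ l)
    (hk : k ≤ r - 1) (h : k < tableK u r τ) (t : ℕ) :
    min (t * k) u + min (t * l) (u - r) = genericCorank u r k l t := by
  by_cases hc : k ≤ l ∧ k ≤ r - k
  · exact sum_min_typeA_of_le hu hc.1 hc.2 t
  obtain ⟨q1, -, q3⟩ := tableQ_spec hτ hu
  rw [lt_tableK_iff hτ] at h
  generalize tableQ u r τ = q at *
  have h2 : (k - τ) * 2 ≤ (k - τ) * (q + 1) := Nat.mul_le_mul_left _ (by omega)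
  have hlk : l < k := by omega
  have hkl : l ≤ r - k := by omega
  have hm : min k (min l (r - k)) = l := by omega
  rw [genericCorank, genericOrder, hm, mul_add]
  obtain ⟨y, rfl⟩ := Nat.exists_eq_add_of_le hτl
  obtain ⟨x, rfl⟩ := Nat.exists_eq_add_of_lt hlk
  have e0 : τ + y + x + 1 - τ = y + (x + 1) := by omega
  rw [e0] at h
  rcases le_or_gt t (q + 1) with ht | ht
  · have h3 : t * (x + 1) ≤ (x + 1) * (q + 1) := by
      rw [mul_comm]; exact Nat.mul_le_mul_left _ ht
    have h4 : y * 2 ≤ y * (q + 1) := Nat.mul_le_mul_left _ (by omega)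
    have e1 : t * (τ + y + x + 1) = t * (τ + y) + t * (x + 1) := by ring
    rw [add_mul] at h
    rw [e1]
    omega
  · obtain ⟨z, rfl⟩ : ∃ z, t = q + 2 + z := ⟨t - (q + 2), by omega⟩
    have e2 : (q + 2 + z) * (τ + y) = τ * q + 2 * (τ + y) + (y * q + z * (τ + y)) := by ring
    rw [e2]
    generalize (q + 2 + z) * (τ + y + x + 1) = a at *
    omega

/-- On both legs of the hook m = τ. The point is that once tτ exceeds u - r, the excursion term
gives e_t = r - 2τ + tτ, because then r - 2τ ≤ t(k - τ). -/
theorem sum_min_typeB (hu : r < u) {τ : ℕ} (hτ : 1 ≤ τ) (hrτ : 2 * τ < r)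
    (h : (tableC u r τ ≤ k ∧ k ≤ r - τ ∧ l = τ) ∨ (k = r - τ ∧ τ < l))
    {t : ℕ} (ht : 1 ≤ t) :
    min (t * τ) (u - r + 2 * τ) + min (t * (k + l - τ)) (u - 2 * τ)
      = genericCorank u r k l t := by
  obtain ⟨q1, q2, q3⟩ := tableQ_spec hτ hu
  obtain ⟨c1, c2⟩ := tableC_le_iff (k := k) hτ hu hrτ
  have key : τ < k ∧ k ≤ r - τ ∧ τ ≤ l ∧ (l = τ ∨ k = r - τ) ∧
      (u - r < t * τ → r - 2 * τ ≤ t * (k - τ)) := by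
    rcases h with ⟨h1, h2, rfl⟩ | ⟨rfl, h2⟩
    · have hpos : l < k := by
        by_contra hk
        have hk0 : k - l = 0 := by omega
        rw [hk0] at c1 c2
        simp only [zero_mul] at c1 c2
        by_cases hd : tableD u r l = 0
        · have := (c1 hd).1 h1; omega
        · have := (c2 hd).1 h1; omega
      refine ⟨hpos, h2, le_rfl, Or.inl rfl, fun hs => ?_⟩
      by_cases hd : tableD u r l = 0
      · have h3 := (c1 hd).1 h1
        rw [tableD] at hd
        have hqt : tableQ u r l < t := by
          by_contra hn
          have : l * t ≤ l * tableQ u r l := Nat.mul_le_mul_left _ (by omega)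
          rw [mul_comm] at this
          omega
        have : (k - l) * (tableQ u r l + 1) ≤ (k - l) * t := Nat.mul_le_mul_left _ hqt
        rw [mul_comm t]
        omega
      · have h3 := (c2 hd).1 h1
        have hqt : tableQ u r l ≤ t := by
          by_contra hn
          have : l * t ≤ l * (tableQ u r l - 1) := Nat.mul_le_mul_left _ (by omega)
          rw [mul_comm] at this
          omega
        have : (k - l) * (tableQ u r l) ≤ (k - l) * t := Nat.mul_le_mul_left _ hqt
        rw [mul_comm t]
        omega
    · refine ⟨by omega, le_rfl, h2.le, Or.inr rfl, fun _ => ?_⟩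
      have : 1 * (r - τ - τ) ≤ t * (r - τ - τ) := Nat.mul_le_mul_right _ ht
      omega
  obtain ⟨k1, k2, k3, k4, k5⟩ := key
  have hm : min k (min l (r - k)) = τ := by omega
  rw [genericCorank, genericOrder, hm]
  obtain ⟨x, rfl⟩ := Nat.exists_eq_add_of_le k1.le
  obtain ⟨y, rfl⟩ := Nat.exists_eq_add_of_le k3
  have e1 : τ + x + (τ + y) - τ = τ + x + y := by omega
  have e2 : τ + x - τ = x := by omega
  rw [e2] at k5
  rw [e1]
  have e3 : t * (τ + x + y) = t * τ + t * x + t * y := by ring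
  have e4 : t * (τ + x + (τ + y)) = t * τ + t * x + (t * τ + t * y) := by ring
  have e5 : t * (τ + x) = t * τ + t * x := by ring
  rw [e3, e4, e5]
  have hy : y = 0 ∨ r - 2 * τ ≤ t * x := by
    rcases k4 with h4 | h4
    · left; omega
    · right
      have : 1 * x ≤ t * x := Nat.mul_le_mul_right _ ht
      omega
  have hy' : t * y = 0 ∨ r - 2 * τ ≤ t * x := hy.imp_left fun h => by rw [h, mul_zero]
  generalize t * τ = a at *
  generalize t * x = b at *
  generalize t * y = c at *
  obtain ⟨ρ, rfl⟩ := Nat.exists_eq_add_of_le hrτ.le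
  obtain ⟨s, rfl⟩ := Nat.exists_eq_add_of_le hu.le
  simp only [Nat.add_sub_cancel_left] at *
  rw [show 2 * τ + ρ + s - 2 * τ = ρ + s by omega]
  clear h hτ hrτ hu hm e1 e2 e3 e4 e5 q1 q2 q3 c1 c2 k1 k2 k3 k4 hy
  rcases le_or_gt a s with ha | ha
  · rcases hy' with rfl | hy'
    · rw [min_eq_left (by omega)]
      omega
    · rw [min_eq_left (by omega)]
      omega
  · have hb := k5 ha
    omega

theorem typeC_facts (hu : r < u) {τ : ℕ} (hτ : 1 ≤ τ) (hrτ : 2 * τ < r)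
    (hτs : τ ≤ u - r) (h1 : tableK u r τ ≤ k) (h2 : k < tableC u r τ) :
    1 ≤ tableD u r τ ∧ tableD u r τ < τ ∧ τ < k ∧ 2 ≤ tableQ u r τ ∧
      τ * tableQ u r τ = u - r + tableD u r τ ∧ r - 2 * τ < (k - τ) * (tableQ u r τ + 1) ∧
      (k - τ) * tableQ u r τ < r - 2 * τ := by
  obtain ⟨q1, q2, q3⟩ := tableQ_spec hτ hu
  obtain ⟨c1, c2⟩ := tableC_le_iff (k := k) hτ hu hrτ
  have h3 := h1
  rw [← not_lt, lt_tableK_iff hτ, not_le] at h3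
  have hd : tableD u r τ ≠ 0 := by
    intro hd
    rw [tableC, if_pos hd] at h2
    omega
  have h4 : (k - τ) * tableQ u r τ < r - 2 * τ := by
    rw [← not_le, c2 hd, not_le] at h2
    exact h2
  have hD : tableD u r τ = τ * tableQ u r τ - (u - r) := rfl
  have hτk : τ < k := by
    by_contra hn
    have : k - τ = 0 := by omega
    rw [this, zero_mul] at h3
    omega
  have h5 : τ * tableQ u r τ = τ * (tableQ u r τ - 1) + τ := by
    rw [← Nat.mul_succ]
    congr 1
    omega
  refine ⟨by omega, by omega, hτk, ?_, by omega, h3, h4⟩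
  by_contra hq
  have hq1 : tableQ u r τ = 1 := by omega
  rw [hq1] at hD
  omega

/-- The middle group of parts has average at least q, so its parts are at least q, and the
subtraction defining its size is not truncated. -/
theorem typeC_parts (hu : r < u) {τ q d x : ℕ} (hrτ : 2 * τ < r) (hd : d < τ)
    (hq : 2 ≤ q) (hτq : τ * q = u - r + d) (h2 : x * q < r - 2 * τ) :
    (τ + x - d) * q ≤ u - 2 * τ - d * (q - 1) ∧ d * (q - 1) ≤ u - 2 * τ := by
  obtain ⟨q, rfl⟩ := Nat.exists_eq_add_of_le' (show 1 ≤ q by omega)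
  obtain ⟨w, rfl⟩ := Nat.exists_eq_add_of_lt hd
  have e1 : d + w + 1 + x - d = w + 1 + x := by omega
  rw [e1]
  simp only [Nat.add_sub_cancel]
  have e2 : (w + 1 + x) * (q + 1) = (w + 1) * (q + 1) + x * (q + 1) := by ring
  have e3 : (d + w + 1) * (q + 1) = (w + 1) * (q + 1) + (d * q + d) := by ring
  rw [e2]
  rw [e3] at hτq
  generalize (w + 1) * (q + 1) = a at *
  generalize d * q = b at *
  generalize x * (q + 1) = c at *
  omega

/-- Here (k-τ)q < r - 2τ < (k-τ)(q+1), so e_t switches from tk to the excursion term between t = q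
and t = q+1. At t = q the product tτ overshoots u - r by d, and the d parts q - 1 compensate exactly
this excess. -/
theorem sum_min_typeC (hu : r < u) {τ : ℕ} (hτ : 1 ≤ τ) (hrτ : 2 * τ < r)
    (hτs : τ ≤ u - r) (h1 : tableK u r τ ≤ k) (h2 : k < tableC u r τ) (t : ℕ) :
    min (t * τ) (u - r + 2 * τ)
      + min (t * (k - tableD u r τ)) (u - 2 * τ - tableD u r τ * (tableQ u r τ - 1))
      + tableD u r τ * min t (tableQ u r τ - 1)
      = genericCorank u r k τ t := by
  obtain ⟨d1, d2, k1, q2, hτq, h3, h4⟩ := typeC_facts hu hτ hrτ hτs h1 h2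
  generalize tableQ u r τ = q at *
  generalize tableD u r τ = d at *
  clear h1 h2
  obtain ⟨x, rfl⟩ := Nat.exists_eq_add_of_le k1.le
  rw [Nat.add_sub_cancel_left] at h3 h4
  have hxq : x * 2 ≤ x * q := Nat.mul_le_mul_left _ q2
  have hm : min (τ + x) (min τ (r - (τ + x))) = τ := by omega
  rw [genericCorank, genericOrder, hm]
  obtain ⟨p1, p2⟩ := typeC_parts hu hrτ d2 q2 hτq h4
  obtain ⟨w, rfl⟩ := Nat.exists_eq_add_of_lt d2
  have e1 : d + w + 1 + x - d = w + 1 + x := by omega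
  rw [e1] at p1 ⊢
  obtain ⟨q, rfl⟩ := Nat.exists_eq_add_of_le' (show 1 ≤ q by omega)
  simp only [Nat.add_sub_cancel] at *
  rcases lt_trichotomy t (q + 1) with ht | rfl | ht
  · rw [min_eq_left (show t ≤ q by omega)]
    obtain ⟨z, rfl⟩ := Nat.exists_eq_add_of_le (show t ≤ q by omega)
    have hmono : t * (w + 1 + x) ≤ u - 2 * (d + w + 1) - d * (t + z) := by
      refine le_trans ?_ p1
      rw [mul_comm]
      exact Nat.mul_le_mul_left _ (by omega)
    rw [min_eq_left hmono]
    have f1 : (d + w + 1) * (t + z + 1) = t * (d + w + 1) + z * (d + w + 1) + (d + w + 1) := by ring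
    have f2 : x * (t + z + 1) = t * x + x * (z + 1) := by ring
    have f3 : t * (d + w + 1 + x + (d + w + 1)) = t * (d + w + 1) + t * x + t * (d + w + 1) := by ring
    have f4 : t * (w + 1 + x) + d * t = t * (d + w + 1) + t * x := by ring
    have f5 : t * (d + w + 1 + x) = t * (d + w + 1) + t * x := by ring
    rw [f1] at hτq
    rw [f2] at h4
    rw [f3, f5, add_assoc, f4]
    generalize t * (d + w + 1) = a at *
    generalize z * (d + w + 1) = b at *
    generalize t * x = c at *
    generalize x * (z + 1) = e at *
    clear p1 p2 hmono f1 f2 f3 f4 f5 hxq h3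
    omega
  · rw [mul_comm] at p1
    rw [min_eq_right (show q ≤ q + 1 by omega), min_eq_left p1]
    have f0 : (q + 1) * (d + w + 1) = u - r + d := by rw [mul_comm]; exact hτq
    have f3 : (q + 1) * (d + w + 1 + x + (d + w + 1)) = (u - r + d) + x * (q + 1) + (u - r + d) := by
      rw [← f0]; ring
    have f4 : (q + 1) * (w + 1 + x) + d * q + d = (u - r + d) + x * (q + 1) := by
      rw [← f0]; ring
    have f5 : (q + 1) * (d + w + 1 + x) = (u - r + d) + x * (q + 1) := by
      rw [← f0]; ring
    rw [f3, f5, f0]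
    generalize (q + 1) * (w + 1 + x) = a at *
    generalize x * (q + 1) = c at *
    generalize d * q = e at *
    clear p1 p2 hxq h3 f3 f5 hτq
    omega
  · obtain ⟨z, rfl⟩ : ∃ z, t = q + 2 + z := ⟨t - (q + 2), by omega⟩
    have g1 : (q + 2) * (w + 1 + x) ≤ (q + 2 + z) * (w + 1 + x) :=
      Nat.mul_le_mul_right _ (by omega)
    have g2 : (q + 2) * (d + w + 1) ≤ (q + 2 + z) * (d + w + 1) :=
      Nat.mul_le_mul_right _ (by omega)
    have g3 : x * (q + 2) ≤ x * (q + 2 + z) := Nat.mul_le_mul_left _ (by omega)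
    have f1 : (q + 2) * (d + w + 1) = (d + w + 1) * (q + 1) + (d + w + 1) := by ring
    have f2 : (q + 2) * (w + 1 + x) + d * q + d + d = (d + w + 1) * (q + 1) + (d + w + 1)
      + x * (q + 1 + 1) := by ring
    have f3 : (q + 2 + z) * (d + w + 1 + x + (d + w + 1)) = (q + 2 + z) * (d + w + 1)
      + x * (q + 2 + z) + (q + 2 + z) * (d + w + 1) := by ring
    have f5 : (q + 2 + z) * (d + w + 1 + x) = (q + 2 + z) * (d + w + 1)
      + x * (q + 2 + z) := by ring
    rw [min_eq_right (show q ≤ q + 2 + z by omega), f3, f5, min_eq_right (a := _ * (w + 1 + x))]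
    · rw [f1, hτq] at g2
      clear f1 f2 f3 f5 p1 g1
      rw [show q + 2 = q + 1 + 1 by rfl] at g3
      generalize (q + 2 + z) * (d + w + 1) = a at *
      generalize x * (q + 1 + 1) = c at *
      generalize x * (q + 2 + z) = b at *
      generalize d * q = e at *
      omega
    · refine le_trans ?_ g1
      rw [hτq] at f2
      omega

/-- The right-hand side does not depend on the set containing (k, l), so overlapping rules cannot
conflict. -/
theorem IsTableEntry.spec (hr : 2 ≤ r) (hu : r < u) (hk1 : 1 ≤ k) (hk : k ≤ r - 1)
    (hl1 : 1 ≤ l) (hl : l ≤ u - r) {P : Multiset ℕ} (h : IsTableEntry u r k l P) :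
    0 ∉ P ∧ ∀ t, 1 ≤ t → (P.map (min t)).sum = genericCorank u r k l t := by
  have htmax : ∀ τ, τ ≤ tableTMax u r → 2 * τ < r ∧ τ ≤ u - r := by
    intro τ hτ
    rw [tableTMax] at hτ
    omega
  have hA : 0 ∉ almostRect u k + almostRect (u - r) l := by
    rw [Multiset.mem_add]
    rintro (h0 | h0)
    · exact zero_notMem_almostRect hk1 (by omega) h0
    · exact zero_notMem_almostRect hl1 hl h0
  cases h with
  | typeA τ h1 hτ h =>
    refine ⟨hA, fun t _ => ?_⟩
    rw [Multiset.map_add, Multiset.sum_add, sum_map_min_almostRect hk1,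
      sum_map_min_almostRect hl1]
    exact sum_min_typeA hu h1 (htmax τ hτ).1 h.2.2.1 hk h.2.1 t
  | typeALast h =>
    refine ⟨hA, fun t _ => ?_⟩
    rw [Multiset.map_add, Multiset.sum_add, sum_map_min_almostRect hk1,
      sum_map_min_almostRect hl1]
    obtain ⟨-, h2, h3, h4⟩ := h
    simp only [tableTMax] at h2 h3 h4
    exact sum_min_typeA_of_le hu (by omega) (by omega) t
  | typeC τ h1 hτ h =>
    obtain ⟨h2, h3, h4⟩ := h
    simp only at h2 h3 h4
    subst h4
    obtain ⟨h5, h6⟩ := htmax _ hτ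
    obtain ⟨d1, d2, k1, q2, hτq, h7, h8⟩ := typeC_facts hu h1 h5 h6 h2 h3
    obtain ⟨x, rfl⟩ := Nat.exists_eq_add_of_le k1.le
    rw [Nat.add_sub_cancel_left] at h7 h8
    obtain ⟨p1, p2⟩ := typeC_parts hu h5 d2 q2 hτq h8
    refine ⟨?_, fun t _ => ?_⟩
    · simp only [Multiset.mem_add]
      rintro ((h0 | h0) | h0)
      · exact zero_notMem_almostRect hl1 (by omega) h0
      · refine zero_notMem_almostRect (by omega) (le_trans ?_ p1) h0
        exact Nat.le_mul_of_pos_right _ (by omega)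
      · have := Multiset.eq_of_mem_replicate h0
        omega
    · rw [Multiset.map_add, Multiset.sum_add, Multiset.map_add, Multiset.sum_add,
        sum_map_min_almostRect hl1, sum_map_min_almostRect (by omega), Multiset.map_replicate,
        Multiset.sum_replicate, smul_eq_mul]
      exact sum_min_typeC hu h1 h5 h6 h2 h3 t
  | typeB τ h1 hτ h =>
    obtain ⟨h5, h6⟩ := htmax _ hτ
    have h' : (tableC u r τ ≤ k ∧ k ≤ r - τ ∧ l = τ) ∨ (k = r - τ ∧ τ < l) := by
      rcases h with h | h
      · exact Or.inl h
      · exact Or.inr ⟨h.1, h.2.1⟩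
    refine ⟨?_, fun t ht => ?_⟩
    · rw [Multiset.mem_add]
      rintro (h0 | h0)
      · exact zero_notMem_almostRect h1 (by omega) h0
      · exact zero_notMem_almostRect (by omega) (by omega) h0
    · rw [Multiset.map_add, Multiset.sum_add, sum_map_min_almostRect h1,
        sum_map_min_almostRect (by omega)]
      exact sum_min_typeB hu h1 h5 h' ht

theorem exists_isTableEntry (hr : 2 ≤ r) (hu : r < u) (hk1 : 1 ≤ k) (hk : k ≤ r - 1)
    (hl1 : 1 ≤ l) (hl : l ≤ u - r) : ∃ P, IsTableEntry u r k l P := by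
  have hT : tableTMax u r = min (u - r) ((r - 1) / 2) := rfl
  by_cases hA : k < tableK u r (min l (tableTMax u r))
  · classical
    -- The least such τ satisfies k_(τ-1) ≤ k < k_τ without any monotonicity of k_t.
    have hex : ∃ τ, k < tableK u r τ := ⟨_, hA⟩
    have h1 := Nat.find_spec hex
    have h2 := Nat.find_min' hex hA
    have h3 : Nat.find hex ≠ 0 := by
      intro h0
      rw [h0, tableK, if_pos rfl] at h1
      omega
    have h4 := Nat.find_min hex (m := Nat.find hex - 1) (by omega)
    exact ⟨_, .typeA (Nat.find hex) (by omega) (by omega) ⟨not_lt.1 h4, h1, by simp only; omega, hl⟩⟩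
  · have hB : ∀ τ, 1 ≤ τ → τ ≤ tableTMax u r → k = r - τ → τ < l → ∃ P, IsTableEntry u r k l P :=
      fun τ h1 h2 h3 h4 => ⟨_, .typeB τ h1 h2 (Or.inr ⟨h3, h4, hl⟩)⟩
    rcases le_or_gt l (tableTMax u r) with hlt | hlt
    · rw [min_eq_left hlt] at hA
      rcases le_or_gt k (r - l) with hkl | hkl
      · rcases lt_or_ge k (tableC u r l) with hc | hc
        · exact ⟨_, .typeC l hl1 hlt ⟨not_lt.1 hA, hc, rfl⟩⟩
        · exact ⟨_, .typeB l hl1 hlt (Or.inl ⟨hc, hkl, rfl⟩)⟩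
      · exact hB (r - k) (by omega) (by omega) (by omega) (by omega)
    · rw [min_eq_right hlt.le] at hA
      rcases le_or_gt (r - k) (tableTMax u r) with hkt | hkt
      · exact hB (r - k) (by omega) hkt (by omega) (by omega)
      -- Since t_max < l ≤ u - r, here t_max = ⌊(r-1)/2⌋. Then t_max + 1 ≤ k_(t_max) ≤ k ≤ r - t_max
      -- - 1 ≤ t_max + 1 forces equality throughout.
      · have hK : tableTMax u r + 1 ≤ tableK u r (tableTMax u r) := by
          rw [tableK]
          generalize (r - 2 * tableTMax u r) / (tableQ u r (tableTMax u r) + 1) = D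
          split_ifs <;> omega
        refine ⟨_, .typeALast ⟨?_, ?_, hlt, hl⟩⟩
        · simp only; omega
        · simp only; omega

end Table

/-! ### Reduction of density to an irreducible family -/

section Density

variable {K : Type*} [Field K]

theorem MvPolynomial.exists_eval_ne_zero_and [Infinite K] {σ : Type*} {p q : MvPolynomial σ K}
    (hp : ∃ θ, MvPolynomial.eval θ p ≠ 0) (hq : ∃ θ, MvPolynomial.eval θ q ≠ 0) :
    ∃ θ, MvPolynomial.eval θ p ≠ 0 ∧ MvPolynomial.eval θ q ≠ 0 := by
  have hp' : p ≠ 0 := by rintro rfl; simp at hp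
  have hq' : q ≠ 0 := by rintro rfl; simp at hq
  by_contra! h
  refine mul_ne_zero hp' hq' (MvPolynomial.funext fun θ => ?_)
  rw [map_mul, map_zero]
  by_cases h0 : MvPolynomial.eval θ p = 0
  · rw [h0, zero_mul]
  · rw [h θ h0, mul_zero]

theorem eval_bind₁_matrix {σ ι : Type*} (Φ : Matrix ι ι (MvPolynomial σ K))
    (G : MvPolynomial (ι × ι) K) (θ : σ → K) :
    MvPolynomial.eval θ (MvPolynomial.bind₁ (fun x : ι × ι => Φ x.1 x.2) G)
      = MvPolynomial.eval (fun x : ι × ι => (Φ.map (MvPolynomial.eval θ)) x.1 x.2) G := by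
  simp only [Matrix.map_apply]
  exact MvPolynomial.eval₂Hom_bind₁ _ _ _ _

theorem eval_mvPolynomialX_pow {ι : Type*} [Fintype ι] [DecidableEq ι] (A : Matrix ι ι K)
    (t : ℕ) (x y : ι) :
    MvPolynomial.eval (fun x : ι × ι => A x.1 x.2) ((Matrix.mvPolynomialX ι ι K ^ t) x y)
      = (A ^ t) x y := by
  have h := congrArg (· ^ t) (Matrix.mvPolynomialX_mapMatrix_eval A)
  simp only [← map_pow] at h
  exact congrFun (congrFun h x) y

theorem symbolMat_map {S S' : Type*} [CommRing S] [CommRing S'] (φ : S →+* S') (r : ℕ)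
    (a g h b : PowerSeries S) :
    (symbolMat r a g h b).map (PowerSeries.map φ)
      = symbolMat r (PowerSeries.map φ a) (PowerSeries.map φ g) (PowerSeries.map φ h)
        (PowerSeries.map φ b) := by
  ext i j
  fin_cases i <;> fin_cases j <;> simp [symbolMat]

/-- The member with parameters `c` of the family of matrices `[α, γ; η, β]` that are products of
a column and a row modulo `X ^ n`, in the form of a symbol. -/
noncomputable def paramSymbol {S : Type*} [CommRing S] (r k b n : ℕ) (c : Fin 8 → PowerSeries S) :
    Matrix (Fin 2) (Fin 2) (PowerSeries S) :=
  symbolMat r (PowerSeries.X ^ k * (c 0 * c 2 + PowerSeries.X ^ n * c 4))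
    (c 0 * c 3 + PowerSeries.X ^ n * c 5) (c 1 * c 2 + PowerSeries.X ^ n * c 6)
    (PowerSeries.X ^ b * (c 1 * c 3 + PowerSeries.X ^ n * c 7))

/-- The polynomial `G` does not vanish identically on the parametrized family of matrices. -/
def NonvanishingOnFamily (u r k b n : ℕ)
    (G : MvPolynomial ((Fin u ⊕ Fin (u - r)) × (Fin u ⊕ Fin (u - r))) K) : Prop :=
  ∃ c : Fin 8 → PowerSeries K, MvPolynomial.eval
    (fun x : (Fin u ⊕ Fin (u - r)) × (Fin u ⊕ Fin (u - r)) =>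
      commMat u (u - r) (paramSymbol r k b n c) x.1 x.2) G ≠ 0

variable {u r k b n : ℕ}

/-- The matrix entries are polynomials in the coefficients of c, so pulling back to these parameters
reduces the claim to irreducibility of affine space over an infinite field. -/
theorem NonvanishingOnFamily.mul [Infinite K]
    {G H : MvPolynomial ((Fin u ⊕ Fin (u - r)) × (Fin u ⊕ Fin (u - r))) K}
    (hG : NonvanishingOnFamily u r k b n G) (hH : NonvanishingOnFamily u r k b n H) :
    NonvanishingOnFamily u r k b n (G * H) := by
  let C : Fin 8 → PowerSeries (MvPolynomial (Fin 8 × ℕ) K) :=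
    fun j => PowerSeries.mk fun n => MvPolynomial.X (j, n)
  let Φ := commMat u (u - r) (paramSymbol r k b n C)
  have hΦ : ∀ θ, Φ.map (MvPolynomial.eval θ) = commMat u (u - r) (paramSymbol r k b n
      fun j => PowerSeries.mk fun n => θ (j, n)) := by
    intro θ
    have hC : ∀ j, PowerSeries.map (MvPolynomial.eval θ) (C j)
        = PowerSeries.mk fun n => θ (j, n) := by
      intro j
      ext n
      simp [C]
    simp only [Φ, commMat_map, paramSymbol, symbolMat_map, map_add, map_mul, map_pow,
      PowerSeries.map_X, hC]
  have hlift : ∀ {G : MvPolynomial ((Fin u ⊕ Fin (u - r)) × (Fin u ⊕ Fin (u - r))) K},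
      NonvanishingOnFamily u r k b n G →
      ∃ θ, MvPolynomial.eval θ (MvPolynomial.bind₁ (fun x => Φ x.1 x.2) G) ≠ 0 := by
    rintro G ⟨c, hc⟩
    refine ⟨fun x => PowerSeries.coeff x.2 (c x.1), ?_⟩
    rw [eval_bind₁_matrix, hΦ]
    have : (fun j => PowerSeries.mk fun n => PowerSeries.coeff n (c j)) = c := by
      ext j n
      simp
    simpa only [this] using hc
  obtain ⟨θ, h1, h2⟩ := MvPolynomial.exists_eval_ne_zero_and (hlift hG) (hlift hH)
  refine ⟨fun j => PowerSeries.mk fun n => θ (j, n), ?_⟩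
  rw [← hΦ θ, map_mul, ← eval_bind₁_matrix, ← eval_bind₁_matrix]
  exact mul_ne_zero h1 h2

theorem nonvanishingOnFamily_one :
    NonvanishingOnFamily u r k b n
      (1 : MvPolynomial ((Fin u ⊕ Fin (u - r)) × (Fin u ⊕ Fin (u - r))) K) :=
  ⟨0, by simp⟩

/-- A point with a unit in the first column lies in the parametrized family. -/
theorem exists_paramSymbol_eq_of_unit {α β γ η : PowerSeries K}
    (h : PowerSeries.X ^ n ∣ α * β - γ * η)
    (hu : PowerSeries.constantCoeff α ≠ 0 ∨ PowerSeries.constantCoeff η ≠ 0) :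
    ∃ c, paramSymbol r k b n c
      = symbolMat r (PowerSeries.X ^ k * α) γ η (PowerSeries.X ^ b * β) := by
  obtain ⟨δ, hδ⟩ := h
  rcases hu with hu | hu
  · obtain ⟨ι, hι⟩ := (PowerSeries.isUnit_iff_constantCoeff.2 hu.isUnit).exists_right_inv
    -- Column (1, η/α) times row (α, γ); the defect in the last entry is X^n δ/α.
    refine ⟨![1, η * ι, α, γ, 0, 0, 0, ι * δ], ?_⟩
    have h1 : η * ι * α = η := by linear_combination η * hι
    have h2 : η * ι * γ + PowerSeries.X ^ n * (ι * δ) = β := by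
      linear_combination β * hι - ι * hδ
    simp [paramSymbol, h1, h2]
  · obtain ⟨ι, hι⟩ := (PowerSeries.isUnit_iff_constantCoeff.2 hu.isUnit).exists_right_inv
    -- Column (α/η, 1) times row (η, β); the defect in the upper right entry is -X^n δ/η.
    refine ⟨![α * ι, 1, η, β, 0, -(ι * δ), 0, 0], ?_⟩
    have h1 : α * ι * η = α := by linear_combination α * hι
    have h2 : α * ι * β + -(PowerSeries.X ^ n * (ι * δ)) = γ := by
      linear_combination γ * hι + ι * hδ
    simp [paramSymbol, h1, h2]

theorem exists_common_X_pow_factor {f g : PowerSeries K}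
    (h : ¬(PowerSeries.X ^ n ∣ f ∧ PowerSeries.X ^ n ∣ g)) :
    ∃ p f' g', f = PowerSeries.X ^ p * f' ∧ g = PowerSeries.X ^ p * g' ∧
      (PowerSeries.constantCoeff f' ≠ 0 ∨ PowerSeries.constantCoeff g' ≠ 0) := by
  classical
  have hex : ∃ p, ¬(PowerSeries.X ^ p ∣ f ∧ PowerSeries.X ^ p ∣ g) := ⟨n, h⟩
  have h1 := Nat.find_spec hex
  obtain ⟨p, hp⟩ : ∃ p, Nat.find hex = p + 1 := by
    refine Nat.exists_eq_succ_of_ne_zero fun h0 => ?_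
    rw [h0] at h1
    simp at h1
  have h2 := not_not.1 (Nat.find_min hex (m := p) (by omega))
  rw [hp] at h1
  obtain ⟨⟨f', rfl⟩, ⟨g', rfl⟩⟩ := h2
  refine ⟨p, f', g', rfl, rfl, ?_⟩
  by_contra! h3
  rw [← PowerSeries.X_dvd_iff, ← PowerSeries.X_dvd_iff] at h3
  rw [pow_succ] at h1
  exact h1 ⟨mul_dvd_mul_left _ h3.1, mul_dvd_mul_left _ h3.2⟩

/-- If the second column is X^p (γ', β') with γ' or β' a unit, adding θ(γ', β') to the first column
leaves αβ - γη unchanged and makes the first column contain a unit for generic θ. At θ = 0 the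
polynomial G is nonzero, so some θ serves both purposes. -/
theorem nonvanishingOnFamily_of_eval_ne_zero [Infinite K]
    {G : MvPolynomial ((Fin u ⊕ Fin (u - r)) × (Fin u ⊕ Fin (u - r))) K} {α β γ η : PowerSeries K}
    (h : PowerSeries.X ^ n ∣ α * β - γ * η)
    (hG : MvPolynomial.eval (fun x : (Fin u ⊕ Fin (u - r)) × (Fin u ⊕ Fin (u - r)) =>
      commMat u (u - r) (symbolMat r (PowerSeries.X ^ k * α) γ η (PowerSeries.X ^ b * β)) x.1 x.2) G
        ≠ 0) :
    NonvanishingOnFamily u r k b n G := by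
  by_cases hdvd : PowerSeries.X ^ n ∣ γ ∧ PowerSeries.X ^ n ∣ β
  · obtain ⟨⟨γ', rfl⟩, ⟨β', rfl⟩⟩ := hdvd
    -- Here the product of the column (α, η) and the row (1, 0) already agrees modulo X^n.
    refine ⟨![α, η, 1, 0, 0, γ', 0, β'], ?_⟩
    simpa [paramSymbol] using hG
  · obtain ⟨p, γ', β', rfl, rfl, h0⟩ := exists_common_X_pow_factor hdvd
    let φ := PowerSeries.map (MvPolynomial.C : K →+* MvPolynomial Unit K)
    let E : PowerSeries (MvPolynomial Unit K) := PowerSeries.C (MvPolynomial.X ())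
    let Φ := commMat u (u - r) (symbolMat r (PowerSeries.X ^ k * (φ α + E * φ γ'))
      (φ (PowerSeries.X ^ p * γ')) (φ η + E * φ β') (PowerSeries.X ^ b * φ (PowerSeries.X ^ p * β')))
    have hΦ : ∀ θ, Φ.map (MvPolynomial.eval θ) = commMat u (u - r) (symbolMat r
        (PowerSeries.X ^ k * (α + PowerSeries.C (θ ()) * γ')) (PowerSeries.X ^ p * γ')
        (η + PowerSeries.C (θ ()) * β') (PowerSeries.X ^ b * (PowerSeries.X ^ p * β'))) := by
      intro θ
      have hφ : ∀ f, PowerSeries.map (MvPolynomial.eval θ) (φ f) = f := by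
        intro f
        ext i
        simp [φ]
      have hE : PowerSeries.map (MvPolynomial.eval θ) E = PowerSeries.C (θ ()) := by
        simp [E]
      simp only [Φ, commMat_map, symbolMat_map, map_add, map_mul, map_pow, hE] at hφ ⊢
      simp [hφ]
    have hunit : ∃ q : MvPolynomial Unit K, (∃ θ, MvPolynomial.eval θ q ≠ 0) ∧
        ∀ θ, MvPolynomial.eval θ q ≠ 0 →
          PowerSeries.constantCoeff (α + PowerSeries.C (θ ()) * γ') ≠ 0 ∨
          PowerSeries.constantCoeff (η + PowerSeries.C (θ ()) * β') ≠ 0 := by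
      have lin : ∀ a c : K, c ≠ 0 → ∃ θ : Unit → K,
          MvPolynomial.eval θ (MvPolynomial.C a + MvPolynomial.X () * MvPolynomial.C c) ≠ 0 := by
        intro a c hc
        refine ⟨fun _ => (1 - a) / c, ?_⟩
        have : a + (1 - a) / c * c = 1 := by field_simp; ring
        simp [this]
      rcases h0 with h0 | h0
      · exact ⟨_, lin (PowerSeries.constantCoeff α) _ h0, fun θ hθ => Or.inl (by simpa using hθ)⟩
      · exact ⟨_, lin (PowerSeries.constantCoeff η) _ h0, fun θ hθ => Or.inr (by simpa using hθ)⟩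
    obtain ⟨q, hq1, hq2⟩ := hunit
    obtain ⟨θ, h1, h2⟩ := MvPolynomial.exists_eval_ne_zero_and
      (p := MvPolynomial.bind₁ (fun x => Φ x.1 x.2) G) ⟨0, by
        rw [eval_bind₁_matrix, hΦ]
        simpa using hG⟩ hq1
    obtain ⟨c, hc⟩ := exists_paramSymbol_eq_of_unit (r := r) (k := k) (b := b) (n := n)
      (α := α + PowerSeries.C (θ ()) * γ') (β := PowerSeries.X ^ p * β')
      (γ := PowerSeries.X ^ p * γ') (η := η + PowerSeries.C (θ ()) * β')
      (by
        convert h using 1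
        ring) (hq2 θ h2)
    refine ⟨c, ?_⟩
    rw [eval_bind₁_matrix, hΦ] at h1
    rwa [hc]

end Density

/-! ### Generic ranks and witnesses -/

section Generic

variable {K : Type*} [Field K] {u r k l : ℕ}

theorem paramSymbol_mem_locusX (hr : 2 ≤ r) (hu : r < u) (hk1 : 1 ≤ k) (hk : k ≤ r - 1)
    (hl1 : 1 ≤ l) (hl : l ≤ u - r) (c : Fin 8 → PowerSeries K) :
    commMat u (u - r) (paramSymbol r k (min l (r - k)) (k + l - r) c) ∈ locusX K u r k l := by
  rw [mem_locusX_iff hr hu hk1 hk hl1 hl]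
  refine ⟨_, _, _, _, ?_, rfl⟩
  exact ⟨c 0 * c 2 * c 7 + c 4 * (c 1 * c 3) + PowerSeries.X ^ (k + l - r) * c 4 * c 7
    - (c 0 * c 3 * c 6 + c 5 * (c 1 * c 2) + PowerSeries.X ^ (k + l - r) * c 5 * c 6), by ring⟩

/-- For e_t < u the bounds from `card_le_rank_pow_add_mul`, `le_rank_commMat` and `rank_commMat_le`
meet. For e_t ≥ u the power vanishes. -/
theorem rank_pow_add_genericCorank (hu : r < u)
    {N : Matrix (Fin 2) (Fin 2) (PowerSeries K)} (h00 : PowerSeries.X ^ k ∣ N 0 0)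
    (h10 : PowerSeries.X ^ r ∣ N 1 0) (h11 : PowerSeries.X ^ min l (r - k) ∣ N 1 1)
    (hdet : PowerSeries.X ^ (k + l) ∣ N.det)
    (hrank : u + (u - r) ≤ (commMat u (u - r) N).rank + (k + l)) {t : ℕ} (ht : 1 ≤ t)
    (hcoeff : genericOrder r k l t < u →
      PowerSeries.coeff (genericOrder r k l t) ((N ^ t) 0 0) ≠ 0) :
    (commMat u (u - r) N ^ t).rank + genericCorank u r k l t = u + (u - r) := by
  have hus : u = r + (u - r) := by omega
  obtain ⟨i, rfl⟩ := Nat.exists_eq_add_of_le' ht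
  obtain ⟨i00, i01, i10, i11⟩ := X_pow_dvd_pow_entries (r := r) (k := k)
    (m := min k (min l (r - k))) (min_le_left _ _) (by omega) h00 h10
    ((pow_dvd_pow _ (min_le_right _ _)).trans h11) i
  have horder : genericOrder r k l (i + 1) = min ((i + 1) * k)
    (r - 2 * min k (min l (r - k)) + (i + 1) * min k (min l (r - k))) := rfl
  rw [← horder] at i00
  have hmr : 2 * min k (min l (r - k)) ≤ r := by omega
  have hmk : min k (min l (r - k)) ≤ k := min_le_left _ _
  have hml : min k (min l (r - k)) ≤ l := by omega
  rw [genericCorank]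
  generalize min k (min l (r - k)) = m at *
  generalize genericOrder r k l (i + 1) = e at *
  have e1 : (i + 1) * m = i * m + m := by ring
  have e2 : (i + 1) * (k + l) = (i + 1) * k + (i + 1) * l := by ring
  rcases lt_or_ge e u with he | he
  · have hlow := Matrix.card_le_rank_pow_add_mul (A := commMat u (u - r) N) (c := k + l)
      (by simpa using hrank) (i + 1)
    rw [commMat_pow hus N h10] at hlow ⊢
    simp only [Fintype.card_sum, Fintype.card_fin] at hlow
    obtain ⟨p, hp⟩ := i00
    have hp0 : PowerSeries.constantCoeff p ≠ 0 := by
      have := hcoeff he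
      rw [hp] at this
      have h1 := PowerSeries.coeff_X_pow_mul p e 0
      rw [zero_add] at h1
      rwa [h1, PowerSeries.coeff_zero_eq_constantCoeff_apply] at this
    have hlow' := le_rank_commMat (u := u) (s := u - r) hp0 hp
    have hup := rank_commMat_le hus hp0 hp ((pow_dvd_pow _ (by omega)).trans i10)
      ((pow_dvd_pow _ (by omega)).trans i10) ((pow_dvd_pow _ (by omega)).trans i01)
      (D := (i + 1) * (k + l))
      (by rw [Matrix.det_pow, mul_comm, pow_mul]; exact pow_dvd_pow_of_dvd hdet _)
      he.le (by omega)
    omega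
  · have hzero : commMat u (u - r) N ^ (i + 1) = 0 := by
      rw [commMat_pow hus N h10]
      apply commMat_eq_zero
      intro j
      fin_cases j
      · exact ⟨(pow_dvd_pow _ (by omega)).trans i00, (pow_dvd_pow _ (by omega)).trans i01⟩
      · exact ⟨(pow_dvd_pow _ (by omega)).trans i10, (pow_dvd_pow _ (by omega)).trans i11⟩
    have e3 : (i + 1) * m ≤ (i + 1) * l := Nat.mul_le_mul_left _ hml
    rw [hzero, Matrix.rank_zero]
    omega

/-- The rows of the minor that certifies that the generic corank is at most `k + l`. -/
def minorRow (u s k l : ℕ) : Fin (u - k) ⊕ Fin (s - l) → Fin u ⊕ Fin s :=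
  Sum.map (fun i => ⟨i.val, by omega⟩) (fun i => ⟨i.val, by omega⟩)

/-- The columns of the minor that certifies that the generic corank is at most `k + l`. -/
def minorCol (u s k l : ℕ) : Fin (u - k) ⊕ Fin (s - l) → Fin u ⊕ Fin s :=
  Sum.map (fun i => ⟨i.val + k, by omega⟩) (fun i => ⟨i.val + l, by omega⟩)

/-- The leading coefficient of the upper left entry of the `t`-th power, as a polynomial. -/
noncomputable def leadingPoly (K : Type*) [Field K] (u r k l t : ℕ) :
    MvPolynomial ((Fin u ⊕ Fin (u - r)) × (Fin u ⊕ Fin (u - r))) K :=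
  if h : genericOrder r k l t < u then
    (Matrix.mvPolynomialX (Fin u ⊕ Fin (u - r)) (Fin u ⊕ Fin (u - r)) K ^ t)
      (Sum.inl ⟨0, by omega⟩) (Sum.inl ⟨genericOrder r k l t, h⟩)
  else 1

/-- The polynomial whose nonvanishing makes a matrix of the locus generic. -/
noncomputable def genericPoly (K : Type*) [Field K] (u r k l : ℕ) :
    MvPolynomial ((Fin u ⊕ Fin (u - r)) × (Fin u ⊕ Fin (u - r))) K :=
  ((Matrix.mvPolynomialX (Fin u ⊕ Fin (u - r)) (Fin u ⊕ Fin (u - r)) K).submatrix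
    (minorRow u (u - r) k l) (minorCol u (u - r) k l)).det *
  ∏ i ∈ Finset.range u, leadingPoly K u r k l (i + 1)

theorem eval_leadingPoly (hu : r < u)
    {N : Matrix (Fin 2) (Fin 2) (PowerSeries K)} (h10 : PowerSeries.X ^ r ∣ N 1 0) {t : ℕ}
    (h : genericOrder r k l t < u) :
    MvPolynomial.eval (fun x : (Fin u ⊕ Fin (u - r)) × (Fin u ⊕ Fin (u - r)) =>
      commMat u (u - r) N x.1 x.2) (leadingPoly K u r k l t)
      = PowerSeries.coeff (genericOrder r k l t) ((N ^ t) 0 0) := by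
  rw [leadingPoly, dif_pos h, eval_mvPolynomialX_pow, commMat_pow (by omega) N h10, commMat_apply]
  simp

theorem eval_det_submatrix {ι κ : Type*} [Fintype κ] [DecidableEq κ]
    (A : Matrix ι ι K) (f g : κ → ι) :
    MvPolynomial.eval (fun x : ι × ι => A x.1 x.2) ((Matrix.mvPolynomialX ι ι K).submatrix f g).det
      = (A.submatrix f g).det := by
  rw [RingHom.map_det]
  congr 1
  ext i j
  simp [Matrix.mvPolynomialX]

theorem rank_pow_of_eval_genericPoly_ne_zero (hr : 2 ≤ r) (hu : r < u) (hk1 : 1 ≤ k)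
    (hk : k ≤ r - 1) (hl1 : 1 ≤ l) (hl : l ≤ u - r)
    {A : Matrix (Fin u ⊕ Fin (u - r)) (Fin u ⊕ Fin (u - r)) K} (hA : A ∈ locusX K u r k l)
    (hF : MvPolynomial.eval (fun x : (Fin u ⊕ Fin (u - r)) × (Fin u ⊕ Fin (u - r)) => A x.1 x.2)
      (genericPoly K u r k l) ≠ 0) {t : ℕ} (ht : 1 ≤ t) :
    (A ^ t).rank + genericCorank u r k l t = u + (u - r) := by
  rw [genericPoly, map_mul, eval_det_submatrix, map_prod] at hF
  have hminor := card_le_rank_of_det_submatrix_ne_zero _ _ _ (left_ne_zero_of_mul hF)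
  have hlead := Finset.prod_ne_zero_iff.1 (right_ne_zero_of_mul hF)
  simp only [Fintype.card_sum, Fintype.card_fin] at hminor
  rw [mem_locusX_iff hr hu hk1 hk hl1 hl] at hA
  obtain ⟨α, β, γ, η, ⟨δ, h⟩, rfl⟩ := hA
  set N := symbolMat r (PowerSeries.X ^ k * α) γ η (PowerSeries.X ^ min l (r - k) * β) with hN
  have h10 : PowerSeries.X ^ r ∣ N 1 0 := by simp [hN, symbolMat]
  refine rank_pow_add_genericCorank hu (by simp [hN, symbolMat]) h10 (by simp [hN, symbolMat])
    ?_ (by omega) ht ?_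
  · have hdet : N.det = PowerSeries.X ^ (k + min l (r - k)) * (α * β)
        - PowerSeries.X ^ r * (γ * η) := by
      rw [Matrix.det_fin_two]
      simp only [hN, symbolMat, Matrix.of_apply, Matrix.cons_val', Matrix.cons_val_zero,
        Matrix.cons_val_one, Matrix.cons_val_fin_one]
      ring
    rw [hdet]
    by_cases hkl : k + l ≤ r
    · rw [min_eq_left (by omega)]
      exact dvd_sub (dvd_mul_right _ _) ((pow_dvd_pow _ hkl).mul_right _)
    · rw [min_eq_right (by omega), show k + (r - k) = r by omega, ← mul_sub, h, ← mul_assoc,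
        ← pow_add, show r + (k + l - r) = k + l by omega]
      exact dvd_mul_right _ _
  · intro hlt
    -- For t > u the order e_t is at least t, because k and m are positive; so the factors with t ≤
    -- u suffice.
    have htu : t - 1 < u := by
      by_contra hn
      have h1 : t * 1 ≤ t * k := Nat.mul_le_mul_left _ hk1
      have h2 : t * 1 ≤ t * min k (min l (r - k)) := Nat.mul_le_mul_left _ (by omega)
      rw [genericOrder] at hlt
      omega
    have := hlead (t - 1) (Finset.mem_range.2 htu)
    rw [Nat.sub_add_cancel ht] at this
    rwa [eval_leadingPoly hu h10 hlt] at this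

theorem symbolMat_pow_of_diagonal (r : ℕ) (a b : PowerSeries K) (t : ℕ) :
    (symbolMat r a 0 0 b ^ t) 0 0 = a ^ t ∧ (symbolMat r a 0 0 b ^ t) 0 1 = 0 := by
  induction t with
  | zero => simp
  | succ t ih =>
    simp only [pow_succ, Matrix.mul_apply, Fin.sum_univ_two, ih]
    simp [symbolMat]

/-- The single excursion 0 → 1 → ⋯ → 1 → 0 is the unique walk of least order, so the coefficient is
1 in every characteristic. -/
theorem coeff_symbolMat_pow {r k m : ℕ} (hmk : m < k) (hmr : 2 * m < r) {i : ℕ}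
    (hi : r + i * m < (i + 2) * k) :
    PowerSeries.coeff (r + i * m)
      ((symbolMat r (PowerSeries.X ^ k : PowerSeries K) 1 1 (PowerSeries.X ^ m) ^ (i + 2)) 0 0)
      = 1 := by
  set N := symbolMat r (PowerSeries.X ^ k : PowerSeries K) 1 1 (PowerSeries.X ^ m) with hN
  have e00 : N 0 0 = PowerSeries.X ^ k := rfl
  have e01 : N 0 1 = 1 := rfl
  have e10 : N 1 0 = PowerSeries.X ^ r := by simp [hN, symbolMat]
  have e11 : N 1 1 = PowerSeries.X ^ m := rfl
  have hp := fun j => (X_pow_dvd_pow_entries (r := r) hmk.le hmr.le e00.symm.dvd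
    e10.symm.dvd e11.symm.dvd j).1
  have h01 : ∀ j, PowerSeries.X ^ (j * m + 1) ∣ (N ^ (j + 1)) 0 1 - PowerSeries.X ^ (j * m) := by
    intro j
    induction j with
    | zero => simp [e01]
    | succ j ih =>
      have h1 : (N ^ (j + 1 + 1)) 0 1 - PowerSeries.X ^ ((j + 1) * m)
          = (N ^ (j + 1)) 0 0 + ((N ^ (j + 1)) 0 1 - PowerSeries.X ^ (j * m)) * PowerSeries.X ^ m := by
        rw [pow_succ N (j + 1), Matrix.mul_apply, Fin.sum_univ_two, e01, e11]
        ring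
      rw [h1]
      have h2 : (j + 1) * m + 1 ≤ (j + 1) * k := Nat.mul_lt_mul_of_pos_left hmk (by omega)
      refine dvd_add ((pow_dvd_pow _ (by omega)).trans (hp j)) ?_
      rw [show (j + 1) * m + 1 = j * m + 1 + m by ring, pow_add]
      exact mul_dvd_mul_right ih _
  obtain ⟨f, hf⟩ := h01 i
  have h3 : (N ^ (i + 2)) 0 0 = PowerSeries.X ^ (r + i * m)
      + ((N ^ (i + 1)) 0 0 * PowerSeries.X ^ k + PowerSeries.X ^ (r + i * m + 1) * f) := by
    rw [pow_succ N (i + 1), Matrix.mul_apply, Fin.sum_univ_two, e00, e10]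
    linear_combination PowerSeries.X ^ r * hf
  have h4 : PowerSeries.X ^ (r + i * m + 1) ∣
      (N ^ (i + 1)) 0 0 * PowerSeries.X ^ k + PowerSeries.X ^ (r + i * m + 1) * f := by
    refine dvd_add ?_ (dvd_mul_right _ _)
    have h5 : (i + 2) * k = (i + 1) * k + k := by ring
    have h6 : (i + 1) * m = i * m + m := by ring
    refine (pow_dvd_pow _ (show r + i * m + 1 ≤
      min ((i + 1) * k) (r - 2 * m + (i + 1) * m) + k by omega)).trans ?_
    rw [pow_add]
    exact mul_dvd_mul_right (hp i) _
  rw [h3, map_add, PowerSeries.coeff_X_pow_self, PowerSeries.X_pow_dvd_iff.1 h4 _ (by omega),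
    add_zero]

theorem nonvanishingOnFamily_leadingPoly (hu : r < u) (hk1 : 1 ≤ k) (hk : k ≤ r - 1) (i : ℕ) :
    NonvanishingOnFamily u r k (min l (r - k)) (k + l - r) (leadingPoly K u r k l (i + 1)) := by
  by_cases h : genericOrder r k l (i + 1) < u
  swap
  · rw [leadingPoly, dif_neg h]
    exact nonvanishingOnFamily_one
  set m := min k (min l (r - k)) with hm
  have horder : genericOrder r k l (i + 1)
    = min ((i + 1) * k) (r - 2 * m + (i + 1) * m) := rfl
  by_cases hle : (i + 1) * k ≤ r - 2 * m + (i + 1) * m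
  -- When staying at vertex 0 is cheapest, α = 1 with the other entries 0 realizes the order tk.
  · refine ⟨![1, 0, 1, 0, 0, 0, 0, 0], ?_⟩
    have hN : paramSymbol r k (min l (r - k)) (k + l - r)
        (![1, 0, 1, 0, 0, 0, 0, 0] : Fin 8 → PowerSeries K)
        = symbolMat r (PowerSeries.X ^ k) 0 0 0 := by simp [paramSymbol]
    rw [hN, eval_leadingPoly hu (by simp [symbolMat]) h, (symbolMat_pow_of_diagonal _ _ _ _).1,
      horder, min_eq_left hle, ← pow_mul, mul_comm, PowerSeries.coeff_X_pow_self]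
    exact one_ne_zero
  · have hmk : m < k := by
      by_contra hn
      have : (i + 1) * k ≤ (i + 1) * m := Nat.mul_le_mul_left _ (by omega)
      omega
    have hi : i ≠ 0 := by
      rintro rfl
      omega
    obtain ⟨j, rfl⟩ := Nat.exists_eq_succ_of_ne_zero hi
    have e1 : r - 2 * m + (j.succ + 1) * m = r + j * m := by
      have : (j.succ + 1) * m = j * m + 2 * m := by rw [Nat.succ_eq_add_one]; ring
      omega
    -- Otherwise α = β = γ = η = 1 makes the excursion term appear.
    refine ⟨![1, 1, 1, 1, 0, 0, 0, 0], ?_⟩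
    have hN : paramSymbol r k (min l (r - k)) (k + l - r)
        (![1, 1, 1, 1, 0, 0, 0, 0] : Fin 8 → PowerSeries K)
        = symbolMat r (PowerSeries.X ^ k) 1 1 (PowerSeries.X ^ m) := by
      rw [hm, min_eq_right (show min l (r - k) ≤ k by omega)]
      simp [paramSymbol]
    rw [hN, eval_leadingPoly hu (by simp [symbolMat]) h, horder, min_eq_right (by omega), e1]
    rw [e1] at hle
    rw [coeff_symbolMat_pow hmk (by omega) (not_le.1 hle)]
    exact one_ne_zero

theorem nonvanishingOnFamily_minor (hk : k ≤ r) :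
    NonvanishingOnFamily u r k (min l (r - k)) (k + l - r)
      ((Matrix.mvPolynomialX (Fin u ⊕ Fin (u - r)) (Fin u ⊕ Fin (u - r)) K).submatrix
        (minorRow u (u - r) k l) (minorCol u (u - r) k l)).det := by
  -- This is the symbol diag(X^k, X^l), for which the chosen minor is the identity.
  refine ⟨![1, 0, 1, 0, 0, 0, 0, 1], ?_⟩
  have hN : paramSymbol r k (min l (r - k)) (k + l - r)
      (![1, 0, 1, 0, 0, 0, 0, 1] : Fin 8 → PowerSeries K)
      = symbolMat r (PowerSeries.X ^ k) 0 0 (PowerSeries.X ^ l) := by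
    have : min l (r - k) + (k + l - r) = l := by omega
    simp [paramSymbol, ← pow_add, this]
  rw [hN, eval_det_submatrix]
  have : (commMat u (u - r) (symbolMat r (PowerSeries.X ^ k : PowerSeries K) 0 0
      (PowerSeries.X ^ l))).submatrix (minorRow u (u - r) k l) (minorCol u (u - r) k l) = 1 := by
    ext i j
    rw [Matrix.submatrix_apply, commMat_apply, Matrix.one_apply]
    rcases i with i | i <;> rcases j with j | j <;>
      simp [minorRow, minorCol, symbolMat, ← pow_add, PowerSeries.coeff_X_pow, Fin.ext_iff, eq_comm]
  rw [this, Matrix.det_one]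
  exact one_ne_zero

theorem nonvanishingOnFamily_genericPoly [Infinite K] (hu : r < u) (hk1 : 1 ≤ k)
    (hk : k ≤ r - 1) :
    NonvanishingOnFamily u r k (min l (r - k)) (k + l - r) (genericPoly K u r k l) := by
  refine (nonvanishingOnFamily_minor (by omega)).mul ?_
  exact Finset.prod_induction _ (NonvanishingOnFamily u r k (min l (r - k)) (k + l - r))
    (fun _ _ => NonvanishingOnFamily.mul) nonvanishingOnFamily_one
    fun i _ => nonvanishingOnFamily_leadingPoly hu hk1 hk i

end Generic

theorem theorem4p1 (K : Type*) [Field K] [Infinite K] (u r k l : ℕ)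
    (hr : 2 ≤ r) (hu : r < u) (hk1 : 1 ≤ k) (hk : k ≤ r - 1) (hl1 : 1 ≤ l) (hl : l ≤ u - r) :
    (∃ P : Multiset ℕ, IsTableEntry u r k l P) ∧
    ∀ P : Multiset ℕ, IsTableEntry u r k l P →
      HoldsGenerically (locusX K u r k l) (fun A => HasJordanType A P) := by
  refine ⟨exists_isTableEntry hr hu hk1 hk hl1 hl, fun P hP => ?_⟩
  obtain ⟨h0, hsum⟩ := hP.spec hr hu hk1 hk hl1 hl
  refine ⟨genericPoly K u r k l, fun A hA hF => ?_, ?_⟩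
  · refine hasJordanType_of_rank_pow hA.1.1 h0 fun t => ?_
    rcases Nat.eq_zero_or_pos t with rfl | ht
    · simp [Matrix.rank_one]
    · rw [hsum t ht, rank_pow_of_eval_genericPoly_ne_zero hr hu hk1 hk hl1 hl hA hF ht]
      simp
  · rintro G ⟨A, hA, hG⟩
    rw [mem_locusX_iff hr hu hk1 hk hl1 hl] at hA
    obtain ⟨α, β, γ, η, h, rfl⟩ := hA
    -- A common nonvanishing point of G and the genericity polynomial is found in the family, which
    -- lies inside the locus.
    obtain ⟨c, hc⟩ := (nonvanishingOnFamily_of_eval_ne_zero h hG).mul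
      (nonvanishingOnFamily_genericPoly (l := l) hu hk1 hk)
    rw [map_mul] at hc
    exact ⟨_, paramSymbol_mem_locusX hr hu hk1 hk hl1 hl c, left_ne_zero_of_mul hc,
      right_ne_zero_of_mul hc⟩
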